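/- Let $G$ be a locally compact (Hausdorff) group — for instance a second countable one — and let $\mathcal E$ be a class of complex Banach spaces. **Groups.** A continuous isometric representation $(\pi,E)$ of $G$ is a homomorphism $\pi$ from $G$ to the group $\mathrm{Iso}(E)$ of surjective linear isometries of a Banach space $E$ such that $s\mapsto\pi(s)\xi$ is continuous for every $\xi\in E$; let $E^\pi$ be its space of invariant vectors. A linear isometric action almost has invariant vectors if for every compact $K\subseteq G$ and $\varepsilon>0$ there is a unit vector $\xi$ with $\|s\xi-\xi\|<\varepsilon$ for all $s\in K$. $G$ has *property $(\mathrm T_{\mathcal E})$* (Bader–Furman–Gelander–Monod) if for every continuous isometric representation $(\pi,E)$ with $E\in\mathcal E$ the quotient representation on $E/E^\pi$ does not almost have invariant vectors. $G$ has *weak property $(\mathrm T_{\mathcal E})$* if every such $(\pi,E)$ which almost has invariant vectors has a non-zero invariant vector. **The algebra $F^*_{\mathcal E}(G)$.** Let $\mathcal R$ be the class of continuous isometric representations of $G$ on spaces in $\mathcal E$, and $\mathcal R^*$ the smallest class of continuous isometric representations which contains $\mathcal R$ and contains the dual representation $\pi^*(s)\eta=\eta\circ\pi(s^{-1})$ on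 $E^*$ of each of its members $(\pi,E)$ for which $\pi^*$ is again continuous. Then $F^*_{\mathcal E}(G)$ is the (Hausdorff) completion of the convolution algebra $L^1(G)$ with respect to the seminorm $\|f\|=\sup\{\|\pi(f)\|:\pi\in\mathcal R^*\}$, where $\pi(f)\xi=\int_G f(s)\pi(s)\xi\,ds$ for a left Haar measure $ds$. **Banach algebras.** Let $A$ be a Banach algebra with a bounded approximate unit. An $A$-bimodule is a Banach space $E$ with commuting contractive representations of $A$ (written $a\cdot\xi$) and of $A^{\mathrm{op}}$ (written $\xi\cdot a$) on $E$; it is essential if the span of $A\cdot E\cdot A$ is dense in $E$. A multiplier of $A$ is a pair $x=(L,R)$ of bounded linear maps $A\to A$ with $aL(b)=R(a)b$ for all $a,b\in A$; the strict topology on the space $\mathrm M(A)$ of multipliers is given by the seminorms $(L,R)\mapsto\|L(a)\|+\|R(a)\|$, $a\in A$. Both actions on an essential bimodule extend uniquely to $\mathrm M(A)$ by bounded operators satisfying $x\cdot(a\cdot\xi)=L(a)\cdot\xi$ and $(\xi\cdot a)\cdot x=\xi\cdot R(a)$. A vector $\xi$ is central if $a\cdot\xi=\xi\cdot a$ for all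 $a\in A$. A net $(\xi_i)$ in $E$ is strictly almost central if $\sup_{x\in S}\|x\cdot\xi_i-\xi_i\cdot x\|\to0$ for every strictly compact $S\subseteq\mathrm M(A)$. $A$ has *property $(\mathrm T_{\mathcal E})$* if for every essential $A$-bimodule $E\in\mathcal E$ and every net $(\xi_i)$ of strictly almost central unit vectors in $E$ there is a net $(\eta_i)$ of central vectors in $E$, over the same index set, with $\|\xi_i-\eta_i\|\to0$. $A$ has *weak property $(\mathrm T_{\mathcal E})$* if every essential $A$-bimodule $E\in\mathcal E$ admitting a net of strictly almost central unit vectors contains a non-zero central vector. **Theorem.** (For algebras, both properties include the existence of a bounded approximate unit.) 1. $G$ has property $(\mathrm T_{\mathcal E})$ if and only if $F^*_{\mathcal E}(G)$ has property $(\mathrm T_{\mathcal E})$; 2. $G$ has weak property $(\mathrm T_{\mathcal E})$ if and only if $F^*_{\mathcal E}(G)$ has weak property $(\mathrm T_{\mathcal E})$. -/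

import Mathlib

open MeasureTheory Filter Topology
open scoped MultiplierAlgebra

universe u v

noncomputable section

/-! ### Classes of Banach spaces and isometric representations -/

/-- A class of (complex) Banach spaces. -/
def BanachClass : Type (u + 1) :=
  ∀ (E : Type u) [NormedAddCommGroup E] [NormedSpace ℂ E] [CompleteSpace E], Prop

/-- A continuous isometric representation of `G` on `E`: a homomorphism into the group of
surjective linear isometries of `E`, continuous for the strong operator topology. -/
structure IsometricRep (G : Type v) [Group G] [TopologicalSpace G]
    (E : Type u) [NormedAddCommGroup E] [NormedSpace ℂ E] where
  toHom : G →* (E ≃ₗᵢ[ℂ] E)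
  continuous_apply : ∀ x : E, Continuous fun s : G => toHom s x

/-- A Banach space together with a continuous isometric representation of `G` on it. -/
structure BanachRep (G : Type v) [Group G] [TopologicalSpace G] where
  space : Type u
  [normed : NormedAddCommGroup space]
  [module : NormedSpace ℂ space]
  [complete : CompleteSpace space]
  rep : IsometricRep G space

attribute [instance] BanachRep.normed BanachRep.module BanachRep.complete

namespace IsometricRep

variable {G : Type v} [Group G] [TopologicalSpace G]
variable {E : Type u} [NormedAddCommGroup E] [NormedSpace ℂ E]

/-- The underlying algebraic representation. -/
def toRepresentation (π : IsometricRep G E) : Representation ℂ G E where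
  toFun s := (π.toHom s).toLinearEquiv.toLinearMap
  map_one' := by ext; simp
  map_mul' s t := by ext; simp

/-- The quotient representation on `E ⧸ E^π`, where `E^π` is the space of invariant vectors. -/
def quotientRep (π : IsometricRep G E) :
    Representation ℂ G (E ⧸ π.toRepresentation.invariants) :=
  π.toRepresentation.quotient π.toRepresentation.invariants (by
    intro s x hx
    have h : π.toRepresentation s x = x := hx s
    simpa [h] using hx)

/-- The dual action on `E*`: `(π*(s) η)(x) = η (π(s⁻¹) x)`. -/
def dualHom (π : IsometricRep G E) : G →* (StrongDual ℂ E ≃ₗᵢ[ℂ] StrongDual ℂ E) where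
  toFun s :=
    { toFun := fun η => η.comp (π.toHom s⁻¹ : E →L[ℂ] E)
      invFun := fun η => η.comp (π.toHom s : E →L[ℂ] E)
      map_add' := fun _ _ => rfl
      map_smul' := fun _ _ => rfl
      left_inv := fun η => by
        ext x
        change η ((π.toHom s⁻¹ * π.toHom s) x) = η x
        rw [← map_mul]; simp
      right_inv := fun η => by
        ext x
        change η ((π.toHom s * π.toHom s⁻¹) x) = η x
        rw [← map_mul]; simp
      norm_map' := fun η => ContinuousLinearMap.opNorm_comp_linearIsometryEquiv η _ }
  map_one' := by ext η x; simp
  map_mul' s t := by ext η x; simp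

/-- The dual representation on `E*`, when it is again a continuous representation. -/
def dual (π : IsometricRep G E)
    (h : ∀ η : StrongDual ℂ E, Continuous fun s : G => π.dualHom s η) :
    IsometricRep G (StrongDual ℂ E) where
  toHom := π.dualHom
  continuous_apply := h

end IsometricRep

/-- `Rep_𝓔(G)`: the continuous isometric representations of `G` on a space in `𝓔`. -/
def repClass (G : Type v) [Group G] [TopologicalSpace G] (𝓔 : BanachClass.{u}) :
    Set (BanachRep.{u, v} G) :=
  Set.ofPred fun ρ => 𝓔 ρ.space

/-- `𝓡*`: the smallest class of continuous isometric representations of `G` which contains `𝓡`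
and is closed under passing to dual representations. -/
inductive DualClosure {G : Type v} [Group G] [TopologicalSpace G]
    (R : Set (BanachRep.{u, v} G)) : BanachRep.{u, v} G → Prop
  | base (ρ : BanachRep.{u, v} G) (h : ρ ∈ R) : DualClosure R ρ
  | dual (ρ : BanachRep.{u, v} G) (h : DualClosure R ρ)
      (hc : ∀ η : StrongDual ℂ ρ.space, Continuous fun s : G => ρ.rep.dualHom s η) :
      DualClosure R ⟨StrongDual ℂ ρ.space, ρ.rep.dual hc⟩

/-! ### Property `(T_𝓔)` for groups -/

section GroupProperty

variable {G : Type v} [Group G] [TopologicalSpace G]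

/-- The representation `ρ` almost has invariant vectors: for every compact `K ⊆ G` and `ε > 0`
there is a unit vector moved by less than `ε` by all elements of `K`. -/
def HasAlmostInvariantVectors {V : Type u} [SeminormedAddCommGroup V] [Module ℂ V]
    (ρ : Representation ℂ G V) : Prop :=
  ∀ K : Set G, IsCompact K → ∀ ε : ℝ, 0 < ε →
    ∃ x : V, ‖x‖ = 1 ∧ ∀ s ∈ K, ‖ρ s x - x‖ < ε

/-- Property `(T_𝓔)` of Bader, Furman, Gelander and Monod: for every continuous isometric
representation `π` on some `E ∈ 𝓔`, the quotient representation on `E ⧸ E^π` does not have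
almost invariant vectors. -/
def GroupPropertyT (G : Type v) [Group G] [TopologicalSpace G] (𝓔 : BanachClass.{u}) : Prop :=
  ∀ (E : Type u) [NormedAddCommGroup E] [NormedSpace ℂ E] [CompleteSpace E], 𝓔 E →
    ∀ π : IsometricRep G E, ¬ HasAlmostInvariantVectors π.quotientRep

/-- Weak property `(T_𝓔)`: every continuous isometric representation on some `E ∈ 𝓔` which
has almost invariant vectors has a non-zero invariant vector. -/
def GroupWeakPropertyT (G : Type v) [Group G] [TopologicalSpace G] (𝓔 : BanachClass.{u}) : Prop :=
  ∀ (E : Type u) [NormedAddCommGroup E] [NormedSpace ℂ E] [CompleteSpace E], 𝓔 E →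
    ∀ π : IsometricRep G E, HasAlmostInvariantVectors π.toRepresentation →
      ∃ x ∈ π.toRepresentation.invariants, x ≠ 0

end GroupProperty

/-! ### The integrated form of an isometric representation -/

section Integrated

variable {G : Type v} [Group G] [TopologicalSpace G] [IsTopologicalGroup G]
  [LocallyCompactSpace G] [MeasurableSpace G] [BorelSpace G]
  (μ : Measure G) [μ.IsHaarMeasure] [μ.Regular]

namespace IsometricRep

variable {E : Type u} [NormedAddCommGroup E] [NormedSpace ℂ E]
variable {μ}

theorem aestronglyMeasurable_restrict (π : IsometricRep G E) (x : E) {S : Set G}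
    (hS : MeasurableSet S) (hμS : μ S ≠ ⊤) :
    AEStronglyMeasurable (fun s => π.toHom s x) (μ.restrict S) := by
  choose K hKS hKc hKcl hKμ using fun n : ℕ =>
    hS.exists_isCompact_isClosed_sdiff_lt (μ := μ) hμS
      (ε := ((n : ENNReal) + 1)⁻¹) (by simp)
  have h1 : (⋃ n, K n) =ᵐ[μ] S := by
    refine (Set.iUnion_subset hKS).eventuallyLE.antisymm (ae_le_set.mpr ?_)
    refine le_antisymm (le_of_forall_gt fun ε hε => ?_) zero_le
    obtain ⟨n, hn⟩ := ENNReal.exists_inv_nat_lt hε.ne'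
    calc μ (S \ ⋃ n, K n) ≤ μ (S \ K n) :=
          measure_mono (Set.sdiff_subset_sdiff_right (Set.subset_iUnion K n))
      _ < ((n : ENNReal) + 1)⁻¹ := hKμ n
      _ ≤ (n : ENNReal)⁻¹ := ENNReal.inv_le_inv.mpr le_self_add
      _ < ε := hn
  rw [← Measure.restrict_congr_set h1, aestronglyMeasurable_iUnion_iff]
  exact fun n => (π.continuous_apply x).continuousOn.aestronglyMeasurable_of_isCompact
    (hKc n) (hKcl n).measurableSet

theorem integrable_smul (π : IsometricRep G E) (f : Lp ℂ 1 μ) (x : E) :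
    Integrable (fun s => f s • π.toHom s x) μ := by
  have hf : Integrable (f : G → ℂ) μ := L1.integrable_coeFn f
  have hfm : StronglyMeasurable (f : G → ℂ) := Lp.stronglyMeasurable f
  refine (hf.norm.mul_const ‖x‖).mono' ?_ (ae_of_all _ fun s => by simp [norm_smul])
  let S : ℕ → Set G := fun n => Set.ofPred fun s => 1 / ((n : ℝ) + 1) ≤ ‖f s‖
  have hSm : ∀ n, MeasurableSet (S n) := fun n =>
    measurableSet_le measurable_const hfm.norm.measurable
  have hSf : ∀ n, μ (S n) ≠ ⊤ := fun n =>
    (hf.measure_norm_ge_lt_top (by positivity)).ne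
  have h1 : AEStronglyMeasurable (fun s => π.toHom s x) (μ.restrict (⋃ n, S n)) :=
    aestronglyMeasurable_iUnion_iff.mpr fun n =>
      π.aestronglyMeasurable_restrict x (hSm n) (hSf n)
  have h2 := (aestronglyMeasurable_indicator_iff (MeasurableSet.iUnion hSm)).mpr h1
  refine (hfm.aestronglyMeasurable.smul h2).congr (ae_of_all _ fun s => ?_)
  by_cases hs : s ∈ ⋃ n, S n
  · simp [Set.indicator_of_mem hs]
  · have h0 : f s = 0 := by
      by_contra h
      obtain ⟨n, hn⟩ := exists_nat_one_div_lt (norm_pos_iff.mpr h)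
      exact hs (Set.mem_iUnion.mpr ⟨n, hn.le⟩)
    simp [h0]

/-- The integrated form `π(f) x = ∫ f(s) π(s) x ds`, for `f ∈ L¹(G)` and `x ∈ E`. -/
def integrated (μ : Measure G) [μ.IsHaarMeasure] [μ.Regular] (π : IsometricRep G E) :
    Lp ℂ 1 μ →L[ℂ] E →L[ℂ] E :=
  LinearMap.mkContinuous₂
    (LinearMap.mk₂ ℂ (fun f x => ∫ s, f s • π.toHom s x ∂μ)
      (fun f g x => by
        rw [← integral_add (π.integrable_smul f x) (π.integrable_smul g x)]
        refine integral_congr_ae ?_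
        filter_upwards [Lp.coeFn_add f g] with s hs
        rw [hs, Pi.add_apply, add_smul])
      (fun c f x => by
        rw [← integral_smul]
        refine integral_congr_ae ?_
        filter_upwards [Lp.coeFn_smul c f] with s hs
        rw [hs, Pi.smul_apply, smul_assoc])
      (fun f x y => by
        rw [← integral_add (π.integrable_smul f x) (π.integrable_smul f y)]
        simp [smul_add])
      (fun c f x => by
        rw [← integral_smul]
        refine integral_congr_ae (ae_of_all _ fun s => ?_)
        change f s • π.toHom s (c • x) = c • f s • π.toHom s x
        rw [map_smul, smul_comm]))
    1
    (fun f x => by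
      rw [LinearMap.mk₂_apply, one_mul]
      refine (norm_integral_le_integral_norm _).trans (le_of_eq ?_)
      simp only [norm_smul, LinearIsometryEquiv.norm_map]
      rw [integral_mul_const, L1.norm_eq_integral_norm])

theorem integrated_apply (π : IsometricRep G E) (f : Lp ℂ 1 μ) (x : E) :
    π.integrated μ f x = ∫ s, f s • π.toHom s x ∂μ := rfl

theorem norm_integrated_le (π : IsometricRep G E) (f : Lp ℂ 1 μ) :
    ‖π.integrated μ f‖ ≤ ‖f‖ := by
  have h : ‖π.integrated μ‖ ≤ 1 := LinearMap.mkContinuous₂_norm_le _ zero_le_one _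
  simpa using (π.integrated μ).le_of_opNorm_le h f

end IsometricRep

/-! ### Convolution on `L¹(G)` -/

/-- The left regular representation of `G` on `L¹(G)`: `(λ_s f)(t) = f(s⁻¹ t)`. -/
def leftRegular : IsometricRep G (Lp ℂ 1 μ) where
  toHom :=
    { toFun := fun s =>
        { toFun := fun f => DomMulAct.mk s⁻¹ • f
          invFun := fun f => DomMulAct.mk s • f
          map_add' := fun f g => smul_add _ f g
          map_smul' := fun c f => smul_comm _ c f
          left_inv := fun f => by
            change DomMulAct.mk s • DomMulAct.mk s⁻¹ • f = f
            rw [← mul_smul, ← DomMulAct.mk_mul]; simp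
          right_inv := fun f => by
            change DomMulAct.mk s⁻¹ • DomMulAct.mk s • f = f
            rw [← mul_smul, ← DomMulAct.mk_mul]; simp
          norm_map' := fun f => DomMulAct.norm_smul_Lp _ f }
      map_one' := by
        ext1 f
        change DomMulAct.mk (1 : G)⁻¹ • f = f
        simp
      map_mul' := fun s t => by
        ext1 f
        change DomMulAct.mk (s * t)⁻¹ • f = DomMulAct.mk s⁻¹ • DomMulAct.mk t⁻¹ • f
        rw [← mul_smul, ← DomMulAct.mk_mul, mul_inv_rev] }
  continuous_apply := fun f => by
    have : Fact ((1 : ENNReal) ≠ ⊤) := ⟨ENNReal.one_ne_top⟩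
    change Continuous fun s : G => DomMulAct.mk s⁻¹ • f
    exact (DomMulAct.continuous_mk.comp continuous_inv).smul continuous_const

variable {μ} in
theorem leftRegular_ae (s : G) (f : Lp ℂ 1 μ) :
    (leftRegular μ).toHom s f =ᵐ[μ] fun t => f (s⁻¹ * t) :=
  DomMulAct.smul_Lp_ae_eq (DomMulAct.mk s⁻¹) f

/-- Convolution on `L¹(G)`, as the `L¹(G)`-valued integral `f * g = ∫ f(s) (λ_s g) ds`; that is,
`(f * g)(t) = ∫ f(s) g(s⁻¹ t) ds` for almost every `t`. -/
def convL1 (f g : Lp ℂ 1 μ) : Lp ℂ 1 μ := (leftRegular μ).integrated μ f g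

variable {μ} in
theorem IsometricRep.integrated_leftRegular {E : Type u} [NormedAddCommGroup E] [NormedSpace ℂ E]
    (π : IsometricRep G E) (s : G) (g : Lp ℂ 1 μ) (x : E) :
    π.integrated μ ((leftRegular μ).toHom s g) x = π.toHom s (π.integrated μ g x) := by
  rw [π.integrated_apply, π.integrated_apply]
  have h1 : ∫ t, ((leftRegular μ).toHom s g) t • π.toHom t x ∂μ
      = ∫ t, g (s⁻¹ * t) • π.toHom t x ∂μ := by
    refine integral_congr_ae ?_
    filter_upwards [leftRegular_ae s g] with t ht
    rw [ht]
  rw [h1, ← integral_mul_left_eq_self _ s]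
  have h2 := (π.toHom s).toContinuousLinearEquiv.integral_comp_comm (μ := μ)
    (fun t => g t • π.toHom t x)
  refine Eq.trans ?_ h2
  simp

variable {μ} in
/-- `π(f * g) = π(f) π(g)`. -/
theorem IsometricRep.integrated_conv {E : Type u} [NormedAddCommGroup E] [NormedSpace ℂ E]
    [CompleteSpace E] (π : IsometricRep G E) (f g : Lp ℂ 1 μ) :
    π.integrated μ (convL1 μ f g) = (π.integrated μ f).comp (π.integrated μ g) := by
  ext x
  have h := ((π.integrated μ).flip x).integral_comp_comm ((leftRegular μ).integrable_smul f g)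
  have h' : π.integrated μ (convL1 μ f g) x = (π.integrated μ).flip x
      (∫ s, f s • (leftRegular μ).toHom s g ∂μ) := rfl
  rw [h', ← h, ContinuousLinearMap.comp_apply, π.integrated_apply]
  refine integral_congr_ae (ae_of_all _ fun s => ?_)
  simp [π.integrated_leftRegular]

end Integrated

/-! ### Symmetrized pseudofunction algebras -/

section Pseudofunctions

variable {G : Type v} [Group G] [TopologicalSpace G] [IsTopologicalGroup G]
  [LocallyCompactSpace G] [MeasurableSpace G] [BorelSpace G]
  (R : Set (BanachRep.{u, v} G)) (μ : Measure G) [μ.IsHaarMeasure] [μ.Regular]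

/-- The seminorm `‖f‖ = sup {‖π(f)‖ : π ∈ 𝓡*}` on `L¹(G)`. -/
def symmNorm (f : Lp ℂ 1 μ) : ℝ :=
  sSup (Set.ofPred fun r : ℝ => ∃ ρ : BanachRep.{u, v} G, DualClosure R ρ ∧ r = ‖ρ.rep.integrated μ f‖)

variable {R μ}

theorem le_symmNorm {ρ : BanachRep.{u, v} G} (hρ : DualClosure R ρ) (f : Lp ℂ 1 μ) :
    ‖ρ.rep.integrated μ f‖ ≤ symmNorm R μ f := by
  refine le_csSup ⟨‖f‖, ?_⟩ ⟨ρ, hρ, rfl⟩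
  rintro r ⟨ρ, -, rfl⟩
  exact ρ.rep.norm_integrated_le f

theorem symmNorm_nonneg (f : Lp ℂ 1 μ) : 0 ≤ symmNorm R μ f := by
  refine Real.sSup_nonneg ?_
  rintro r ⟨ρ, -, rfl⟩
  exact norm_nonneg _

theorem symmNorm_le {f : Lp ℂ 1 μ} {C : ℝ} (hC : 0 ≤ C)
    (h : ∀ ρ : BanachRep.{u, v} G, DualClosure R ρ → ‖ρ.rep.integrated μ f‖ ≤ C) :
    symmNorm R μ f ≤ C := by
  refine Real.sSup_le ?_ hC
  rintro r ⟨ρ, hρ, rfl⟩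
  exact h ρ hρ

variable (R μ)

/-- `L¹(G)`, to be equipped with the convolution product and the seminorm `symmNorm R μ`. -/
def PrePseudo : Type v :=
  let _ := R
  Lp ℂ 1 μ

instance : AddCommGroup (PrePseudo R μ) := inferInstanceAs (AddCommGroup (Lp ℂ 1 μ))

instance : Module ℂ (PrePseudo R μ) := inferInstanceAs (Module ℂ (Lp ℂ 1 μ))

/-- The identity map from `PrePseudo R μ` to `L¹(G)`. -/
def PrePseudo.toL1 : PrePseudo R μ ≃ₗ[ℂ] Lp ℂ 1 μ := LinearEquiv.refl ℂ (Lp ℂ 1 μ)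

instance : Mul (PrePseudo R μ) where
  mul f g := (PrePseudo.toL1 R μ).symm (convL1 μ (PrePseudo.toL1 R μ f) (PrePseudo.toL1 R μ g))

theorem PrePseudo.toL1_mul (f g : PrePseudo R μ) : PrePseudo.toL1 R μ (f * g) =
    (leftRegular μ).integrated μ (PrePseudo.toL1 R μ f) (PrePseudo.toL1 R μ g) :=
  (PrePseudo.toL1 R μ).apply_symm_apply _

instance : NonUnitalRing (PrePseudo R μ) where
  __ := (inferInstance : AddCommGroup (PrePseudo R μ))
  __ := (inferInstance : Mul (PrePseudo R μ))
  left_distrib f g h := (PrePseudo.toL1 R μ).injective (by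
    simp only [PrePseudo.toL1_mul, map_add])
  right_distrib f g h := (PrePseudo.toL1 R μ).injective (by
    simp only [PrePseudo.toL1_mul, map_add, add_apply])
  zero_mul f := (PrePseudo.toL1 R μ).injective (by
    simp only [PrePseudo.toL1_mul, map_zero, zero_apply])
  mul_zero f := (PrePseudo.toL1 R μ).injective (by
    simp only [PrePseudo.toL1_mul, map_zero])
  mul_assoc f g h := (PrePseudo.toL1 R μ).injective (by
    have key := (leftRegular μ).integrated_conv (PrePseudo.toL1 R μ f) (PrePseudo.toL1 R μ g)
    rw [convL1] at key
    simp only [PrePseudo.toL1_mul, key, ContinuousLinearMap.comp_apply])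

instance : IsScalarTower ℂ (PrePseudo R μ) (PrePseudo R μ) where
  smul_assoc c f g := (PrePseudo.toL1 R μ).injective (by
    simp only [smul_eq_mul, PrePseudo.toL1_mul, map_smul, smul_apply])

instance : SMulCommClass ℂ (PrePseudo R μ) (PrePseudo R μ) where
  smul_comm c f g := (PrePseudo.toL1 R μ).injective (by
    simp only [smul_eq_mul, PrePseudo.toL1_mul, map_smul])

/-- The seminorm `symmNorm R μ` on `L¹(G)`. -/
def preSeminorm : Seminorm ℂ (PrePseudo R μ) :=
  Seminorm.ofSMulLE (fun f => symmNorm R μ (PrePseudo.toL1 R μ f))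
    (le_antisymm (symmNorm_le le_rfl fun ρ _ => by simp) (symmNorm_nonneg _))
    (fun f g => symmNorm_le (add_nonneg (symmNorm_nonneg _) (symmNorm_nonneg _)) fun ρ hρ => by
      rw [map_add, map_add]
      exact (norm_add_le _ _).trans (add_le_add (le_symmNorm hρ _) (le_symmNorm hρ _)))
    (fun c f => symmNorm_le (mul_nonneg (norm_nonneg _) (symmNorm_nonneg _)) fun ρ hρ => by
      rw [map_smul, map_smul, norm_smul]
      exact mul_le_mul_of_nonneg_left (le_symmNorm hρ _) (norm_nonneg _))

instance : SeminormedAddCommGroup (PrePseudo R μ) :=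
  (preSeminorm R μ).toAddGroupSeminorm.toSeminormedAddCommGroup

theorem PrePseudo.norm_def (f : PrePseudo R μ) : ‖f‖ = symmNorm R μ (PrePseudo.toL1 R μ f) := rfl

instance : NonUnitalSeminormedRing (PrePseudo R μ) where
  __ := (inferInstance : SeminormedAddCommGroup (PrePseudo R μ))
  __ := (inferInstance : NonUnitalRing (PrePseudo R μ))
  norm_mul_le f g := by
    simp only [PrePseudo.norm_def]
    refine symmNorm_le (mul_nonneg (symmNorm_nonneg _) (symmNorm_nonneg _)) fun ρ hρ => ?_
    have key := ρ.rep.integrated_conv (PrePseudo.toL1 R μ f) (PrePseudo.toL1 R μ g)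
    rw [convL1] at key
    rw [PrePseudo.toL1_mul, key]
    exact (ContinuousLinearMap.opNorm_comp_le _ _).trans
      (mul_le_mul (le_symmNorm hρ _) (le_symmNorm hρ _) (norm_nonneg _) (symmNorm_nonneg _))

instance : NormedSpace ℂ (PrePseudo R μ) where
  norm_smul_le c f := (map_smul_eq_mul (preSeminorm R μ) c f).le

/-- The symmetrized algebra of `𝓡`-pseudofunctions `F*_𝓡(G)`: the (Hausdorff) completion of
`L¹(G)` with respect to `‖f‖ = sup {‖π(f)‖ : π ∈ 𝓡*}`, with the product extending
convolution. -/
def SymmPseudo : Type v := UniformSpace.Completion (PrePseudo R μ)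

instance : NormedAddCommGroup (SymmPseudo R μ) :=
  inferInstanceAs (NormedAddCommGroup (UniformSpace.Completion (PrePseudo R μ)))

instance : NormedSpace ℂ (SymmPseudo R μ) :=
  inferInstanceAs (NormedSpace ℂ (UniformSpace.Completion (PrePseudo R μ)))

instance : CompleteSpace (SymmPseudo R μ) :=
  inferInstanceAs (CompleteSpace (UniformSpace.Completion (PrePseudo R μ)))

/-- The canonical isometric linear map from `L¹(G)`, with the seminorm, to the completion. -/
def SymmPseudo.of : PrePseudo R μ →ₗᵢ[ℂ] SymmPseudo R μ :=
  UniformSpace.Completion.toComplₗᵢ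

theorem SymmPseudo.denseRange_of : DenseRange (SymmPseudo.of R μ) :=
  UniformSpace.Completion.denseRange_coe

instance : Mul (SymmPseudo R μ) where
  mul a b := (UniformSpace.Completion.isDenseInducing_coe.prodMap
      UniformSpace.Completion.isDenseInducing_coe).extend
    (fun p : PrePseudo R μ × PrePseudo R μ => SymmPseudo.of R μ (p.1 * p.2)) (a, b)

theorem SymmPseudo.of_mul (f g : PrePseudo R μ) :
    SymmPseudo.of R μ (f * g) = SymmPseudo.of R μ f * SymmPseudo.of R μ g :=
  ((UniformSpace.Completion.isDenseInducing_coe.prodMap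
      UniformSpace.Completion.isDenseInducing_coe).extend_eq
    (((SymmPseudo.of R μ).continuous).comp continuous_mul) (f, g)).symm

theorem SymmPseudo.continuous_mul' :
    Continuous fun p : SymmPseudo R μ × SymmPseudo R μ => p.1 * p.2 := by
  let m : PrePseudo R μ →+ PrePseudo R μ →+ SymmPseudo R μ :=
    (AddMonoidHom.mul : PrePseudo R μ →+ PrePseudo R μ →+ PrePseudo R μ).compr₂
      (SymmPseudo.of R μ).toLinearMap.toAddMonoidHom
  have hm : Continuous fun p : PrePseudo R μ × PrePseudo R μ => m p.1 p.2 :=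
    ((SymmPseudo.of R μ).continuous).comp continuous_mul
  have di : IsDenseInducing
      (UniformSpace.Completion.toCompl : PrePseudo R μ → UniformSpace.Completion _) :=
    UniformSpace.Completion.isDenseInducing_coe
  exact di.extend_Z_bilin di hm

instance : ContinuousMul (SymmPseudo R μ) := ⟨SymmPseudo.continuous_mul' R μ⟩

variable {R μ} in
theorem SymmPseudo.induction {p : SymmPseudo R μ → Prop} (hp : IsClosed (Set.ofPred p))
    (h : ∀ f, p (SymmPseudo.of R μ f)) (a : SymmPseudo R μ) : p a :=
  (SymmPseudo.denseRange_of R μ).induction_on a hp h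

variable {R μ} in
theorem SymmPseudo.norm_mul_le' (a b : SymmPseudo R μ) : ‖a * b‖ ≤ ‖a‖ * ‖b‖ := by
  induction a using SymmPseudo.induction with
  | hp =>
    exact isClosed_le (continuous_norm.comp (continuous_id.mul continuous_const))
      (continuous_norm.mul continuous_const)
  | h f =>
  induction b using SymmPseudo.induction with
  | hp =>
    exact isClosed_le (continuous_norm.comp (continuous_const.mul continuous_id))
      (continuous_const.mul continuous_norm)
  | h g =>
    rw [← SymmPseudo.of_mul, LinearIsometry.norm_map, LinearIsometry.norm_map,
      LinearIsometry.norm_map]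
    exact norm_mul_le f g

variable {R μ} in
theorem SymmPseudo.mul_assoc' (a b c : SymmPseudo R μ) : a * b * c = a * (b * c) := by
  induction a using SymmPseudo.induction with
  | hp =>
    exact isClosed_eq ((continuous_id.mul continuous_const).mul continuous_const)
      (continuous_id.mul continuous_const)
  | h f =>
  induction b using SymmPseudo.induction with
  | hp =>
    exact isClosed_eq ((continuous_const.mul continuous_id).mul continuous_const)
      (continuous_const.mul (continuous_id.mul continuous_const))
  | h g =>
  induction c using SymmPseudo.induction with
  | hp =>
    exact isClosed_eq (continuous_const.mul continuous_id)
      (continuous_const.mul (continuous_const.mul continuous_id))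
  | h k => rw [← SymmPseudo.of_mul, ← SymmPseudo.of_mul, ← SymmPseudo.of_mul,
      ← SymmPseudo.of_mul, mul_assoc]

variable {R μ} in
theorem SymmPseudo.smul_mul' (c : ℂ) (a b : SymmPseudo R μ) : (c • a) * b = c • (a * b) := by
  induction a using SymmPseudo.induction with
  | hp =>
    exact isClosed_eq ((continuous_const_smul c).mul continuous_const)
      ((continuous_id.mul continuous_const).const_smul c)
  | h f =>
  induction b using SymmPseudo.induction with
  | hp =>
    exact isClosed_eq (continuous_const.mul continuous_id)
      ((continuous_const.mul continuous_id).const_smul c)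
  | h g => rw [← map_smul, ← SymmPseudo.of_mul, ← SymmPseudo.of_mul, ← map_smul, smul_mul_assoc]

variable {R μ} in
theorem SymmPseudo.mul_smul' (c : ℂ) (a b : SymmPseudo R μ) : a * (c • b) = c • (a * b) := by
  induction a using SymmPseudo.induction with
  | hp =>
    exact isClosed_eq (continuous_id.mul continuous_const)
      ((continuous_id.mul continuous_const).const_smul c)
  | h f =>
  induction b using SymmPseudo.induction with
  | hp =>
    exact isClosed_eq (continuous_const.mul (continuous_const_smul c))
      ((continuous_const.mul continuous_id).const_smul c)
  | h g => rw [← map_smul, ← SymmPseudo.of_mul, ← SymmPseudo.of_mul, ← map_smul, mul_smul_comm]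

instance : NonUnitalNormedRing (SymmPseudo R μ) where
  __ := (inferInstance : NormedAddCommGroup (SymmPseudo R μ))
  __ := (inferInstance : Mul (SymmPseudo R μ))
  left_distrib a b c := by
    induction a using SymmPseudo.induction with
    | hp =>
    exact isClosed_eq (by fun_prop) (by fun_prop)
    | h f =>
    induction b using SymmPseudo.induction with
    | hp =>
    exact isClosed_eq (by fun_prop) (by fun_prop)
    | h g =>
    induction c using SymmPseudo.induction with
    | hp =>
    exact isClosed_eq (by fun_prop) (by fun_prop)
    | h k => rw [← map_add, ← SymmPseudo.of_mul, ← SymmPseudo.of_mul, ← SymmPseudo.of_mul,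
        ← map_add, mul_add]
  right_distrib a b c := by
    induction a using SymmPseudo.induction with
    | hp =>
    exact isClosed_eq (by fun_prop) (by fun_prop)
    | h f =>
    induction b using SymmPseudo.induction with
    | hp =>
    exact isClosed_eq (by fun_prop) (by fun_prop)
    | h g =>
    induction c using SymmPseudo.induction with
    | hp =>
    exact isClosed_eq (by fun_prop) (by fun_prop)
    | h k => rw [← map_add, ← SymmPseudo.of_mul, ← SymmPseudo.of_mul, ← SymmPseudo.of_mul,
        ← map_add, add_mul]
  zero_mul a := by
    induction a using SymmPseudo.induction with
    | hp =>
    exact isClosed_eq (by fun_prop) (by fun_prop)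
    | h f => rw [← map_zero (SymmPseudo.of R μ), ← SymmPseudo.of_mul, zero_mul]
  mul_zero a := by
    induction a using SymmPseudo.induction with
    | hp =>
    exact isClosed_eq (by fun_prop) (by fun_prop)
    | h f => rw [← map_zero (SymmPseudo.of R μ), ← SymmPseudo.of_mul, mul_zero]
  mul_assoc a b c := SymmPseudo.mul_assoc' a b c
  norm_mul_le a b := SymmPseudo.norm_mul_le' a b

instance : IsScalarTower ℂ (SymmPseudo R μ) (SymmPseudo R μ) where
  smul_assoc c a b := SymmPseudo.smul_mul' c a b

instance : SMulCommClass ℂ (SymmPseudo R μ) (SymmPseudo R μ) where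
  smul_comm c a b := (SymmPseudo.mul_smul' c a b).symm

end Pseudofunctions

/-! ### Property `(T_𝓔)` for Banach algebras -/

section BanachAlgebra

/-- `A` has a bounded (two-sided) approximate unit. -/
def HasBoundedApproxUnit (A : Type v) [NonUnitalNormedRing A] : Prop :=
  ∃ l : Filter A, l.IsApproximateUnit ∧ ∃ C : ℝ, ∀ᶠ e in l, ‖e‖ ≤ C

/-- An `A`-bimodule structure on the Banach space `E`: commuting contractive representations
`a ↦ (ξ ↦ a · ξ)` of `A` and `a ↦ (ξ ↦ ξ · a)` of the opposite algebra of `A` on `E`. -/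
structure BanachBimodule (A : Type v) [NonUnitalNormedRing A] [NormedSpace ℂ A]
    (E : Type u) [NormedAddCommGroup E] [NormedSpace ℂ E] where
  left : A →ₗ[ℂ] E →L[ℂ] E
  right : A →ₗ[ℂ] E →L[ℂ] E
  left_mul : ∀ a b ξ, left (a * b) ξ = left a (left b ξ)
  right_mul : ∀ a b ξ, right (a * b) ξ = right b (right a ξ)
  norm_left_le : ∀ a, ‖left a‖ ≤ ‖a‖
  norm_right_le : ∀ a, ‖right a‖ ≤ ‖a‖
  comm : ∀ a b ξ, left a (right b ξ) = right b (left a ξ)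

variable {A : Type v} [NonUnitalNormedRing A] [NormedSpace ℂ A]

/-- The strict topology on the multiplier algebra, generated by the seminorms
`(L, R) ↦ ‖L a‖ + ‖R a‖` for `a ∈ A`. -/
abbrev strictTopology (A : Type v) [NonUnitalNormedRing A] [NormedSpace ℂ A]
    [SMulCommClass ℂ A A] [IsScalarTower ℂ A A] : TopologicalSpace 𝓜(ℂ, A) :=
  TopologicalSpace.induced (fun x : 𝓜(ℂ, A) => fun a : A => (x.fst a, x.snd a)) inferInstance

/-- Compactness for the strict topology. -/
def IsStrictlyCompact [SMulCommClass ℂ A A] [IsScalarTower ℂ A A] (S : Set 𝓜(ℂ, A)) : Prop :=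
  @IsCompact _ (strictTopology A) S

namespace BanachBimodule

variable {E : Type u} [NormedAddCommGroup E] [NormedSpace ℂ E]

/-- The span of `A · E · A` is dense in `E`. -/
def IsEssential (M : BanachBimodule A E) : Prop :=
  Dense (Submodule.span ℂ
    (Set.ofPred fun η : E => ∃ (a b : A) (ξ : E), η = M.right b (M.left a ξ)) : Set E)

/-- `ξ` is `A`-central: `a · ξ = ξ · a` for all `a ∈ A`. -/
def IsCentral (M : BanachBimodule A E) (ξ : E) : Prop :=
  ∀ a : A, M.left a ξ = M.right a ξ

variable [SMulCommClass ℂ A A] [IsScalarTower ℂ A A]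

/-- `T` is the left action of the multiplier `x = (L, R)`: `x · (a · ξ) = L(a) · ξ`. -/
def IsLeftExtension (M : BanachBimodule A E) (x : 𝓜(ℂ, A)) (T : E →L[ℂ] E) : Prop :=
  ∀ (a : A) (ξ : E), T (M.left a ξ) = M.left (x.fst a) ξ

/-- `T` is the right action of the multiplier `x = (L, R)`: `(ξ · a) · x = ξ · R(a)`. -/
def IsRightExtension (M : BanachBimodule A E) (x : 𝓜(ℂ, A)) (T : E →L[ℂ] E) : Prop :=
  ∀ (a : A) (ξ : E), T (M.right a ξ) = M.right (x.snd a) ξ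

theorem exists_extension_aux [CompleteSpace E] {l : Filter A} [l.NeBot] {C : ℝ}
    (φ : A →ₗ[ℂ] E →L[ℂ] E) (L : A → A) (U : A → E →L[ℂ] E)
    (hφ : Dense (Submodule.span ℂ (Set.ofPred fun η : E => ∃ (a : A) (ξ : E), η = φ a ξ) : Set E))
    (hU : ∀ᶠ e in l, ‖U e‖ ≤ C)
    (hlim : ∀ a ξ, Tendsto (fun e => U e (φ a ξ)) l (𝓝 (φ (L a) ξ))) :
    ∃! T : E →L[ℂ] E, ∀ a ξ, T (φ a ξ) = φ (L a) ξ := by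
  have hC : 0 ≤ C := by
    obtain ⟨e, he⟩ := hU.exists
    exact (norm_nonneg _).trans he
  have hspan : ∀ ζ ∈ Submodule.span ℂ (Set.ofPred fun η : E => ∃ (a : A) (ξ : E), η = φ a ξ),
      ∃ y, Tendsto (fun e => U e ζ) l (𝓝 y) := by
    intro ζ hζ
    induction hζ using Submodule.span_induction with
    | mem x hx =>
      obtain ⟨a, ξ, rfl⟩ := hx
      exact ⟨_, hlim a ξ⟩
    | zero => exact ⟨0, by simpa using tendsto_const_nhds⟩
    | add x y _ _ hx hy =>
      obtain ⟨u, hu⟩ := hx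
      obtain ⟨v, hv⟩ := hy
      exact ⟨u + v, by simpa using hu.add hv⟩
    | smul c x _ hx =>
      obtain ⟨u, hu⟩ := hx
      exact ⟨c • u, by simpa using hu.const_smul c⟩
  have hall : ∀ ζ, ∃ y, Tendsto (fun e => U e ζ) l (𝓝 y) := by
    intro ζ
    suffices h : Cauchy (Filter.map (fun e => U e ζ) l) by
      obtain ⟨y, hy⟩ := CompleteSpace.complete h
      exact ⟨y, hy⟩
    rw [Metric.cauchy_iff]
    refine ⟨inferInstance, fun ε hε => ?_⟩
    obtain ⟨ζ', hζ', hd⟩ := Metric.dense_iff.mp hφ ζ (ε / (4 * (C + 1))) (by positivity)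
    obtain ⟨y, hy⟩ := hspan ζ' hd
    have hev : ∀ᶠ e in l, U e ζ ∈ Metric.ball y (ε / 2) := by
      filter_upwards [hU, hy (Metric.ball_mem_nhds y (show 0 < ε / 4 by positivity))] with e he1 he2
      rw [Metric.mem_ball, dist_eq_norm] at *
      have h1 : ‖U e (ζ - ζ')‖ ≤ C * (ε / (4 * (C + 1))) := by
        refine ((U e).le_of_opNorm_le he1 _).trans (mul_le_mul_of_nonneg_left ?_ hC)
        rw [norm_sub_rev]
        exact hζ'.le
      have h2 : C * (ε / (4 * (C + 1))) ≤ ε / 4 := by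
        rw [mul_div_assoc', div_le_div_iff₀ (by positivity) (by norm_num)]
        nlinarith
      have he2' : ‖U e ζ' - y‖ < ε / 4 := by
        have := Set.mem_preimage.mp he2
        rwa [Metric.mem_ball, dist_eq_norm] at this
      calc ‖U e ζ - y‖ = ‖U e (ζ - ζ') + (U e ζ' - y)‖ := by rw [map_sub]; congr 1; abel
        _ ≤ ‖U e (ζ - ζ')‖ + ‖U e ζ' - y‖ := norm_add_le _ _
        _ < ε / 2 := by linarith
    refine ⟨Metric.ball y (ε / 2), hev, fun u hu v hv => ?_⟩
    calc dist u v ≤ dist u y + dist v y := dist_triangle_right u v y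
      _ < ε := by rw [Metric.mem_ball] at hu hv; linarith
  choose T hT using hall
  let T' : E →L[ℂ] E := LinearMap.mkContinuous
    { toFun := T
      map_add' := fun x y => tendsto_nhds_unique (hT (x + y)) (by simpa using (hT x).add (hT y))
      map_smul' := fun c x => tendsto_nhds_unique (hT (c • x))
        (by simpa using (hT x).const_smul c) } C
    (fun x => le_of_tendsto (hT x).norm (hU.mono fun e he => (U e).le_of_opNorm_le he x))
  refine ⟨T', fun a ξ => tendsto_nhds_unique (hT _) (hlim a ξ), fun S hS => ?_⟩
  refine ContinuousLinearMap.ext_on hφ ?_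
  rintro _ ⟨a, ξ, rfl⟩
  rw [hS]
  exact (tendsto_nhds_unique (hT _) (hlim a ξ)).symm

/-- The left action of a multiplier on an essential bimodule exists and is unique. -/
theorem existsUnique_isLeftExtension [CompleteSpace E] (hA : HasBoundedApproxUnit A)
    (M : BanachBimodule A E) (hM : M.IsEssential) (x : 𝓜(ℂ, A)) :
    ∃! T, M.IsLeftExtension x T := by
  obtain ⟨l, hl, C, hC⟩ := hA
  have := hl.neBot
  refine exists_extension_aux (l := l) (C := ‖x.snd‖ * C) M.left x.fst
    (fun e => M.left (x.snd e)) (hM.mono (Submodule.span_mono ?_)) ?_ ?_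
  · rintro _ ⟨a, b, ξ, rfl⟩
    exact ⟨a, M.right b ξ, (M.comm a b ξ).symm⟩
  · filter_upwards [hC] with e he
    exact (M.norm_left_le _).trans ((x.snd.le_opNorm e).trans
      (mul_le_mul_of_nonneg_left he (norm_nonneg _)))
  · intro a ξ
    have h : Continuous fun b => M.left b ξ :=
      ((M.left.mkContinuous 1 (by simpa using M.norm_left_le)).flip ξ).continuous
    refine ((h.tendsto _).comp (hl.tendsto_mul_right (x.fst a))).congr fun e => ?_
    rw [Function.comp_apply, ← M.left_mul, x.central]

/-- The right action of a multiplier on an essential bimodule exists and is unique. -/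
theorem existsUnique_isRightExtension [CompleteSpace E] (hA : HasBoundedApproxUnit A)
    (M : BanachBimodule A E) (hM : M.IsEssential) (x : 𝓜(ℂ, A)) :
    ∃! T, M.IsRightExtension x T := by
  obtain ⟨l, hl, C, hC⟩ := hA
  have := hl.neBot
  refine exists_extension_aux (l := l) (C := ‖x.fst‖ * C) M.right x.snd
    (fun e => M.right (x.fst e)) (hM.mono (Submodule.span_mono ?_)) ?_ ?_
  · rintro _ ⟨a, b, ξ, rfl⟩
    exact ⟨b, M.left a ξ, rfl⟩
  · filter_upwards [hC] with e he
    exact (M.norm_right_le _).trans ((x.fst.le_opNorm e).trans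
      (mul_le_mul_of_nonneg_left he (norm_nonneg _)))
  · intro a ξ
    have h : Continuous fun b => M.right b ξ :=
      ((M.right.mkContinuous 1 (by simpa using M.norm_right_le)).flip ξ).continuous
    refine ((h.tendsto _).comp (hl.tendsto_mul_left (x.snd a))).congr fun e => ?_
    rw [Function.comp_apply, ← M.right_mul, x.central]

open Classical in
/-- The extension `ξ ↦ x · ξ` of the left action to the multiplier algebra. If `A` has a bounded
approximate unit and `E` is essential, it exists and is unique. -/
def leftMult (M : BanachBimodule A E) (x : 𝓜(ℂ, A)) : E →L[ℂ] E :=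
  if h : ∃ T, M.IsLeftExtension x T then h.choose else 0

open Classical in
/-- The extension `ξ ↦ ξ · x` of the right action to the multiplier algebra. If `A` has a bounded
approximate unit and `E` is essential, it exists and is unique. -/
def rightMult (M : BanachBimodule A E) (x : 𝓜(ℂ, A)) : E →L[ℂ] E :=
  if h : ∃ T, M.IsRightExtension x T then h.choose else 0

/-- The net `ξ` is strictly almost `A`-central: `x · ξ_i - ξ_i · x → 0` uniformly for `x` in any
given strictly compact set of multipliers. -/
def IsStrictlyAlmostCentral (M : BanachBimodule A E) {I : Type*} [Preorder I] (ξ : I → E) : Prop :=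
  ∀ S : Set 𝓜(ℂ, A), IsStrictlyCompact S → ∀ ε : ℝ, 0 < ε →
    ∃ i₀, ∀ i, i₀ ≤ i → ∀ x ∈ S, ‖M.leftMult x (ξ i) - M.rightMult x (ξ i)‖ < ε

end BanachBimodule

variable (A) [SMulCommClass ℂ A A] [IsScalarTower ℂ A A]

/-- Property `(T_𝓔)` for a Banach algebra `A` (with a bounded approximate unit): for every
essential `A`-bimodule `E ∈ 𝓔` and every net `ξ` of strictly almost central unit vectors in `E`
there is a net `η` of central vectors with `‖ξ_i - η_i‖ → 0`. -/
def AlgebraPropertyT (𝓔 : BanachClass.{u}) : Prop :=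
  HasBoundedApproxUnit A ∧
  ∀ (E : Type u) [NormedAddCommGroup E] [NormedSpace ℂ E] [CompleteSpace E], 𝓔 E →
    ∀ M : BanachBimodule A E, M.IsEssential →
      ∀ (I : Type (max u v)) [Preorder I] [IsDirectedOrder I] [Nonempty I] (ξ : I → E),
        (∀ i, ‖ξ i‖ = 1) → M.IsStrictlyAlmostCentral ξ →
          ∃ η : I → E, (∀ i, M.IsCentral (η i)) ∧ Tendsto (fun i => ‖ξ i - η i‖) atTop (𝓝 0)

/-- Weak property `(T_𝓔)` for a Banach algebra `A` (with a bounded approximate unit): every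
essential `A`-bimodule `E ∈ 𝓔` admitting a net of strictly almost central unit vectors contains a
non-zero central vector. -/
def AlgebraWeakPropertyT (𝓔 : BanachClass.{u}) : Prop :=
  HasBoundedApproxUnit A ∧
  ∀ (E : Type u) [NormedAddCommGroup E] [NormedSpace ℂ E] [CompleteSpace E], 𝓔 E →
    ∀ M : BanachBimodule A E, M.IsEssential →
      ∀ (I : Type (max u v)) [Preorder I] [IsDirectedOrder I] [Nonempty I] (ξ : I → E),
        (∀ i, ‖ξ i‖ = 1) → M.IsStrictlyAlmostCentral ξ →
          ∃ η : E, M.IsCentral η ∧ η ≠ 0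

end BanachAlgebra

/-- `F*_𝓔(G)`, the symmetrized pseudofunction algebra of all representations of `G` on spaces
in `𝓔`. -/
abbrev FStar {G : Type v} [Group G] [TopologicalSpace G] [IsTopologicalGroup G]
    [LocallyCompactSpace G] [MeasurableSpace G] [BorelSpace G]
    (𝓔 : BanachClass.{u}) (μ : Measure G) [μ.IsHaarMeasure] [μ.Regular] : Type v :=
  SymmPseudo (repClass G 𝓔) μ

end

/-!
The algebra `A = F*_𝓔(G)` contains the image of `L¹(G)` as a dense subspace, and two elements of
that image agree as soon as every representation identifies them. This reduces every identity
needed in `A` to a change of variables in one representation. In particular `δ_s` acts on `A` by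
left and right translation, as a multiplier depending strictly continuously on `s`
(`SymmPseudo.dirac`, `SymmPseudo.continuous_dirac`), and the means on small neighbourhoods of the
identity form a contractive approximate unit (`SymmPseudo.isApproximateUnit_approxUnit`). For the
right translations this rests on the continuity of the modular function and of right translation
on `L¹(G)`.

*From groups to algebras.* On an essential bimodule `E`, `ξ ↦ δ_s · ξ · δ_{s⁻¹}` is a continuous
isometric representation of `G` on the same space `E` (`BanachBimodule.conjRep`). The set
`{δ_s : s ∈ K}` is strictly compact for `K` compact, so a strictly almost central net is almost
invariant; and an invariant vector is central, since the left action of `f ∈ L¹(G)` is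
`∫ f(s) δ_s · ds` (`BanachBimodule.isCentral_of_mem_invariants`). If the quotient representation
has no almost invariant vectors, then the distance to the invariant vectors is controlled by the
displacement under a compact set, so that almost invariant nets are asymptotic to invariant ones
(`IsometricRep.IsAlmostInvariant.exists_tendsto`).

*From algebras to groups.* If `E ∈ 𝓔`, then the trivial representation on `E` also belongs to the
class defining the norm of `A`. Hence a representation `π` on `E` turns `E` into an essential
bimodule with left action `π` and right action the trivial representation (`repBimodule`), whose
central vectors are invariant. If the unit vectors `ζ_i` are almost invariant and `e` is a mean on a
compact neighbourhood of the identity, then `π(e) ζ_i` is asymptotic to `ζ_i` and strictly almost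
central: for `x` in a strictly compact set, `x e` ranges over a norm compact subset of `A`
(`exists_isStrictlyAlmostCentral`). For property `(T_𝓔)` one starts from almost invariant vectors in
`E ⧸ E^π` and has to lift them to almost invariant vectors of `E`. Any lift of controlled norm
works, because a displacement `π(s) x - x` at distance less than `δ` from `E^π` has norm less than
`2 δ`: a fixed component `v` of the displacement accumulates to `n v` in `π(sⁿ) x - x`, which is bounded
(`IsometricRep.norm_le_of_norm_sub_sub_le`).
-/

/-! ### Right translation on `L¹(G)` -/

section RightTranslation

open Measure

/-- Near a given point, all right translates of a compactly supported function vanish off a common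
compact set. -/
theorem exists_isCompact_translate_eq_zero {G E : Type*} [Group G] [TopologicalSpace G]
    [IsTopologicalGroup G] [LocallyCompactSpace G] [NormedAddCommGroup E] {F : G → E}
    (hF : HasCompactSupport F) (s₀ : G) :
    ∃ N ∈ 𝓝 s₀, ∃ k, IsCompact k ∧ ∀ s ∈ N, ∀ t ∉ k, F (t * s⁻¹) = 0 := by
  obtain ⟨N, hN, hNs⟩ := exists_compact_mem_nhds s₀
  refine ⟨N, hNs, _, hF.isCompact.mul hN, fun s hs t ht => ?_⟩
  by_contra h
  exact ht ⟨t * s⁻¹, subset_tsupport _ h, s, hs, by simp⟩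

variable {G : Type v} [Group G] [TopologicalSpace G] [IsTopologicalGroup G]
  [LocallyCompactSpace G] [MeasurableSpace G] [BorelSpace G]
  {μ : Measure G} [μ.IsHaarMeasure] [μ.Regular]
variable {E : Type*} [NormedAddCommGroup E]

theorem map_mul_right_eq_modularCharacterFun_smul (s : G) :
    μ.map (· * s) = modularCharacterFun s • μ := by
  have : (μ.map (· * s)).Regular := Regular.map (Homeomorph.mulRight s)
  rw [modularCharacterFun_eq_haarScalarFactor μ s]
  exact isMulLeftInvariant_eq_smul_of_regular _ μ

theorem integral_comp_mul_right_haar [NormedSpace ℝ E] (F : G → E) (s : G) :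
    ∫ t, F (t * s) ∂μ = (modularCharacterFun s : ℝ) • ∫ t, F t ∂μ := by
  have h := (MeasurableEquiv.mulRight s).measurableEmbedding.integral_map (μ := μ) F
  rw [MeasurableEquiv.coe_mulRight, map_mul_right_eq_modularCharacterFun_smul,
    integral_smul_nnreal_measure] at h
  exact h.symm

theorem quasiMeasurePreserving_mul_right_haar (s : G) :
    QuasiMeasurePreserving (· * s) μ μ where
  measurable := measurable_mul_const s
  absolutelyContinuous := by
    rw [map_mul_right_eq_modularCharacterFun_smul]
    exact smul_absolutelyContinuous

theorem integrable_comp_mul_right {F : G → E} (hF : Integrable F μ) (s : G) :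
    Integrable (fun t => F (t * s)) μ := by
  refine (integrable_map_equiv (MeasurableEquiv.mulRight s) F).mp ?_
  rw [MeasurableEquiv.coe_mulRight, map_mul_right_eq_modularCharacterFun_smul]
  exact hF.smul_measure_nnreal

/-- Integrals of a jointly continuous function whose support is locally uniformly compact in the
second variable depend continuously on the first variable. -/
theorem continuous_integral_of_locally_compact_support {X Y : Type*} [TopologicalSpace X]
    [TopologicalSpace Y] [MeasurableSpace Y] [OpensMeasurableSpace Y]
    {ν : Measure Y} [IsFiniteMeasureOnCompacts ν]
    [NormedSpace ℝ E] {F : X → Y → E} (hF : Continuous F.uncurry)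
    (hs : ∀ x₀, ∃ N ∈ 𝓝 x₀, ∃ k, IsCompact k ∧ ∀ x ∈ N, ∀ y ∉ k, F x y = 0) :
    Continuous fun x => ∫ y, F x y ∂ν := by
  refine continuous_iff_continuousAt.mpr fun x₀ => ?_
  obtain ⟨N, hN, k, hk, h⟩ := hs x₀
  exact (continuousOn_integral_of_compact_support hk hF.continuousOn
    (fun p y hp hy => h p hp y hy)).continuousAt hN

theorem continuous_modularCharacterFun :
    Continuous fun s : G => (modularCharacterFun s : ℝ) := by
  borelize G
  let ν : Measure G := haar
  obtain ⟨⟨φ, hφ⟩, hc, h0, h1⟩ :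
    ∃ φ : C(G, ℝ), HasCompactSupport φ ∧ 0 ≤ φ ∧ φ 1 ≠ 0 := exists_continuous_nonneg_pos 1
  have hpos : 0 < ∫ t, φ t ∂ν := hφ.integral_pos_of_hasCompactSupport_nonneg_nonzero hc h0 h1
  have h : Continuous fun s : G => ∫ t, φ (t * s⁻¹⁻¹) ∂ν := by
    refine continuous_integral_of_locally_compact_support
      (F := fun s t => φ (t * s⁻¹⁻¹)) (by fun_prop) fun s₀ => ?_
    obtain ⟨N, hN, k, hk, h⟩ := exists_isCompact_translate_eq_zero hc s₀⁻¹
    exact ⟨(fun s : G => s⁻¹) ⁻¹' N, continuous_inv.continuousAt hN, k, hk, fun s hs => h s⁻¹ hs⟩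
  refine (h.div_const (∫ t, φ t ∂ν)).congr fun s => ?_
  rw [inv_inv]
  rw [integral_comp_mul_right_haar, smul_eq_mul, mul_div_cancel_right₀ _ hpos.ne']

/-- The right translate `(f * δ_s)(t) = Δ(s) f(t s⁻¹)` of `f ∈ L¹(G)`, where `Δ` is the modular
function in the normalisation `∫ f(t s) dt = Δ(s) ∫ f(t) dt`. -/
noncomputable def rightTranslate (μ : Measure G) [μ.IsHaarMeasure] [μ.Regular] (s : G) :
    Lp ℂ 1 μ →ₗ[ℂ] Lp ℂ 1 μ where
  toFun f := Integrable.toL1 (fun t => (modularCharacterFun s : ℝ) • f (t * s⁻¹))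
    ((integrable_comp_mul_right (L1.integrable_coeFn f) s⁻¹).smul (modularCharacterFun s : ℝ))
  map_add' f g := by
    rw [← Integrable.toL1_add, Integrable.toL1_eq_toL1_iff]
    filter_upwards [(quasiMeasurePreserving_mul_right_haar s⁻¹).ae_eq_comp (Lp.coeFn_add f g)]
      with t ht
    simp only [Function.comp_apply, Pi.add_apply] at ht ⊢
    rw [ht, smul_add]
  map_smul' c f := by
    rw [RingHom.id_apply, ← Integrable.toL1_smul, Integrable.toL1_eq_toL1_iff]
    filter_upwards [(quasiMeasurePreserving_mul_right_haar s⁻¹).ae_eq_comp (Lp.coeFn_smul c f)]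
      with t ht
    simp only [Function.comp_apply, Pi.smul_apply] at ht ⊢
    rw [ht, smul_comm]

theorem rightTranslate_ae (s : G) (f : Lp ℂ 1 μ) :
    rightTranslate μ s f =ᵐ[μ] fun t => (modularCharacterFun s : ℝ) • f (t * s⁻¹) :=
  Integrable.coeFn_toL1
    ((integrable_comp_mul_right (L1.integrable_coeFn f) s⁻¹).smul (modularCharacterFun s : ℝ))

/-- `∫ (f * δ_s)(t) F(t) dt = ∫ f(t) F(t s) dt`, for a bilinear pairing. -/
theorem integral_rightTranslate {E' : Type*} [NormedAddCommGroup E'] [NormedSpace ℝ E']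
    (B : ℂ → G → E') (hB : ∀ (c : ℝ) z t, B (c • z) t = c • B z t) (s : G) (f : Lp ℂ 1 μ) :
    ∫ t, B (rightTranslate μ s f t) t ∂μ = ∫ t, B (f t) (t * s) ∂μ := by
  have h := integral_comp_mul_right_haar (μ := μ) (fun t => B (f (t * s⁻¹)) t) s
  simp only [mul_inv_cancel_right] at h
  rw [h, ← integral_smul]
  refine integral_congr_ae ?_
  filter_upwards [rightTranslate_ae s f] with t ht
  rw [ht, hB]

theorem norm_rightTranslate (s : G) (f : Lp ℂ 1 μ) : ‖rightTranslate μ s f‖ = ‖f‖ := by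
  rw [L1.norm_eq_integral_norm, L1.norm_eq_integral_norm]
  have h := integral_comp_mul_right_haar (μ := μ) (fun t => ‖f (t * s⁻¹)‖) s
  simp only [mul_inv_cancel_right] at h
  rw [h, ← integral_smul]
  refine integral_congr_ae ?_
  filter_upwards [rightTranslate_ae s f] with t ht
  rw [ht, norm_smul, smul_eq_mul, NNReal.norm_eq]

theorem IsometricRep.integrated_rightTranslate {E : Type u} [NormedAddCommGroup E]
    [NormedSpace ℂ E] (π : IsometricRep G E) (s : G) (f : Lp ℂ 1 μ)
    (x : E) : π.integrated μ (rightTranslate μ s f) x = π.integrated μ f (π.toHom s x) := by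
  rw [π.integrated_apply, π.integrated_apply]
  have h := integral_rightTranslate (fun z t => z • π.toHom t x)
    (fun c z t => smul_assoc c z _) s f
  rw [h]
  simp [map_mul]

/-- A family of uniformly bounded operators converges pointwise as soon as it does so on a set with
dense span. -/
theorem tendsto_of_dense_span {ι : Type*} {E F : Type*} [NormedAddCommGroup E] [NormedSpace ℂ E]
    [NormedAddCommGroup F] [NormedSpace ℂ F] {l : Filter ι} {T : ι → E →L[ℂ] F} {S : E →L[ℂ] F}
    {C : ℝ} (hT : ∀ᶠ i in l, ‖T i‖ ≤ C) {D : Set E} (hD : Dense (Submodule.span ℂ D : Set E))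
    (h : ∀ x ∈ D, Tendsto (fun i => T i x) l (𝓝 (S x))) (x : E) :
    Tendsto (fun i => T i x) l (𝓝 (S x)) := by
  have hspan : ∀ y ∈ Submodule.span ℂ D, Tendsto (fun i => T i y) l (𝓝 (S y)) := by
    intro y hy
    induction hy using Submodule.span_induction with
    | mem y hy => exact h y hy
    | zero => simpa using tendsto_const_nhds
    | add y z _ _ hy hz => simpa using hy.add hz
    | smul c y _ hy => simpa using hy.const_smul c
  have hC : 0 ≤ max C 0 := le_max_right _ _
  rw [Metric.tendsto_nhds]
  intro ε hε
  have hpos : 0 < max C 0 + ‖S‖ + 1 := by positivity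
  obtain ⟨y, hy, hxy⟩ := Metric.dense_iff.mp hD x (ε / 2 / (max C 0 + ‖S‖ + 1)) (by positivity)
  rw [Metric.mem_ball, dist_comm, dist_eq_norm, lt_div_iff₀ hpos] at hy
  filter_upwards [hT, Metric.tendsto_nhds.mp (hspan y hxy) (ε / 2) (by positivity)] with i hi hiy
  rw [dist_eq_norm] at hiy ⊢
  have h1 : ‖T i (x - y)‖ ≤ max C 0 * ‖x - y‖ :=
    (T i).le_of_opNorm_le (hi.trans (le_max_left _ _)) _
  have h2 : ‖S (x - y)‖ ≤ ‖S‖ * ‖x - y‖ := S.le_opNorm _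
  calc ‖T i x - S x‖ = ‖T i (x - y) + (T i y - S y) - S (x - y)‖ := by
        rw [map_sub, map_sub]; congr 1; abel
    _ ≤ ‖T i (x - y)‖ + ‖T i y - S y‖ + ‖S (x - y)‖ :=
        (norm_sub_le _ _).trans (add_le_add_left (norm_add_le _ _) _)
    _ < ε := by nlinarith [norm_nonneg (x - y)]

theorem continuous_of_dense_span {X : Type*} [TopologicalSpace X] {E F : Type*}
    [NormedAddCommGroup E] [NormedSpace ℂ E] [NormedAddCommGroup F] [NormedSpace ℂ F]
    {T : X → E →L[ℂ] F} {C : ℝ} (hT : ∀ i, ‖T i‖ ≤ C) {D : Set E}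
    (hD : Dense (Submodule.span ℂ D : Set E)) (h : ∀ x ∈ D, Continuous fun i => T i x) (x : E) :
    Continuous fun i => T i x :=
  continuous_iff_continuousAt.mpr fun _ => tendsto_of_dense_span (.of_forall hT) hD
    (fun y hy => (h y hy).tendsto _) x

/-- Continuous compactly supported functions are dense in `L¹(G)`. -/
theorem dense_hasCompactSupport_L1 :
    Dense (Set.ofPred fun f : Lp ℂ 1 μ => ∃ g : G → ℂ, Continuous g ∧ HasCompactSupport g ∧
      f =ᵐ[μ] g) := by
  intro f
  rw [EMetric.mem_closure_iff]
  intro ε hε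
  obtain ⟨ε', hε', hlt⟩ := exists_between hε
  have key : ∃ g : G → ℂ, eLpNorm (⇑f - g) 1 μ ≤ ε' ∧
      Continuous g ∧ HasCompactSupport g ∧ MemLp g 1 μ := by
    refine (Lp.memLp f).induction_dense ENNReal.one_ne_top _ ?_ ?_ ?_ hε'.ne'
    · -- a finite measure set is approximated by a compact set from inside, and the compact set
      -- by an open set from outside; Urysohn's lemma interpolates between the latter two
      intro c t ht htμ ε hε
      obtain ⟨δ, δpos, hδ⟩ := exists_Lp_half ℂ μ 1 hε
      obtain ⟨η, ηpos, hη⟩ :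
          ∃ η : NNReal, 0 < η ∧ ∀ s : Set G, μ s ≤ η → eLpNorm (s.indicator fun _ => c) 1 μ ≤ δ :=
        exists_eLpNorm_indicator_le ENNReal.one_ne_top c δpos.ne'
      have hη0 : (η : ENNReal) ≠ 0 := (ENNReal.coe_pos.2 ηpos).ne'
      obtain ⟨k, kt, hk, hkc, hkη⟩ := ht.exists_isCompact_isClosed_sdiff_lt htμ.ne hη0
      obtain ⟨V, kV, hV, -, hVη⟩ :=
        hkc.measurableSet.exists_isOpen_sdiff_lt (μ := μ) hk.measure_lt_top.ne hη0
      obtain ⟨g, hg1, hg0, hgc, hg⟩ := exists_continuous_one_zero_of_isCompact hk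
        hV.isClosed_compl (Set.disjoint_compl_right_iff_subset.mpr kV)
      have hcont : Continuous fun x => (g x : ℂ) * c := by fun_prop
      have hcs : HasCompactSupport fun x => (g x : ℂ) * c :=
        HasCompactSupport.mul_right (hgc.comp_left Complex.ofReal_zero)
      have hm : MemLp (fun x => (g x : ℂ) * c) 1 μ := hcont.memLp_of_hasCompactSupport hcs
      refine ⟨_, ?_, hcont, hcs, hm⟩
      have I1 : eLpNorm ((k.indicator fun _ => c) - t.indicator fun _ => c) 1 μ ≤ δ := by
        rw [← eLpNorm_neg, neg_sub, ← Set.indicator_sdiff kt]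
        exact hη _ hkη.le
      have I2 : eLpNorm ((fun x => (g x : ℂ) * c) - k.indicator fun _ => c) 1 μ ≤ δ := by
        refine (eLpNorm_mono fun x => ?_).trans (hη _ hVη.le)
        rw [Pi.sub_apply]
        by_cases hxk : x ∈ k
        · simp [hg1 hxk, hxk]
        · by_cases hxV : x ∈ V
          · simp only [Set.indicator_of_notMem hxk, sub_zero, norm_mul, Complex.norm_real,
              Set.indicator_of_mem (show x ∈ V \ k from ⟨hxV, hxk⟩)]
            rw [Real.norm_of_nonneg (hg x).1]
            exact mul_le_of_le_one_left (norm_nonneg _) (hg x).2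
          · simp [hg0 hxV, hxk]
      convert! (hδ _ _ (hm.aestronglyMeasurable.sub
        (aestronglyMeasurable_const.indicator hkc.measurableSet))
        ((aestronglyMeasurable_const.indicator hkc.measurableSet).sub
          (aestronglyMeasurable_const.indicator ht)) I2 I1).le using 2
      simp only [sub_add_sub_cancel]
    · rintro f g ⟨hf, hfc, hfm⟩ ⟨hg, hgc, hgm⟩
      exact ⟨hf.add hg, hfc.add hgc, hfm.add hgm⟩
    · rintro f ⟨-, -, hfm⟩
      exact hfm.aestronglyMeasurable
  obtain ⟨g, hg, hgcont, hgc, hgm⟩ := key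
  refine ⟨hgm.toLp g, ⟨g, hgcont, hgc, hgm.coeFn_toLp⟩, lt_of_le_of_lt ?_ hlt⟩
  rw [Lp.edist_def]
  refine le_of_eq_of_le (eLpNorm_congr_ae ?_) hg
  filter_upwards [hgm.coeFn_toLp] with t ht
  simp [ht]

theorem continuous_rightTranslate (f : Lp ℂ 1 μ) :
    Continuous fun s : G => rightTranslate μ s f := by
  let T : G → Lp ℂ 1 μ →L[ℂ] Lp ℂ 1 μ := fun s =>
    (rightTranslate μ s).mkContinuous 1 fun f => by rw [one_mul, norm_rightTranslate]
  refine continuous_of_dense_span (T := T)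
    (fun s => LinearMap.mkContinuous_norm_le _ zero_le_one _)
    (dense_hasCompactSupport_L1.mono Submodule.subset_span) ?_ f
  rintro f ⟨g, hg, hgc, hfg⟩
  refine continuous_iff_continuousAt.mpr fun s₀ => ?_
  rw [ContinuousAt, tendsto_iff_norm_sub_tendsto_zero]
  let F : G → G → ℂ := fun s t => (modularCharacterFun s : ℝ) • g (t * s⁻¹) -
    (modularCharacterFun s₀ : ℝ) • g (t * s₀⁻¹)
  have hF : Continuous F.uncurry := by
    have h := (continuous_modularCharacterFun (G := G)).comp (continuous_fst (Y := G))
    exact (h.smul (hg.comp (by fun_prop))).sub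
      ((continuous_const (y := (modularCharacterFun s₀ : ℝ))).smul (hg.comp (by fun_prop)))
  have hFs : Continuous fun s => ∫ t, ‖F s t‖ ∂μ := by
    refine continuous_integral_of_locally_compact_support (F := fun s t => ‖F s t‖)
      hF.norm fun s₁ => ?_
    obtain ⟨N, hN, k, hk, h⟩ := exists_isCompact_translate_eq_zero hgc s₁
    obtain ⟨N', hN', k', hk', h'⟩ := exists_isCompact_translate_eq_zero hgc s₀
    refine ⟨N, hN, k ∪ k', hk.union hk', fun s hs t ht => ?_⟩
    rw [Set.mem_union, not_or] at ht
    simp [F, h s hs t ht.1, h' s₀ (mem_of_mem_nhds hN') t ht.2]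
  have h0 : ∫ t, ‖F s₀ t‖ ∂μ = 0 := by simp [F]
  refine (h0 ▸ hFs.tendsto s₀).congr fun s => ?_
  rw [L1.norm_eq_integral_norm]
  refine integral_congr_ae ?_
  filter_upwards [Lp.coeFn_sub (T s f) (T s₀ f), rightTranslate_ae s f, rightTranslate_ae s₀ f,
    (quasiMeasurePreserving_mul_right_haar s⁻¹).ae_eq_comp hfg,
    (quasiMeasurePreserving_mul_right_haar s₀⁻¹).ae_eq_comp hfg] with t h1 h2 h3 h4 h5
  simp only [Function.comp_apply] at h4 h5
  rw [h1, Pi.sub_apply]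
  change _ = ‖rightTranslate μ s f t - rightTranslate μ s₀ f t‖
  rw [h2, h3, h4, h5]

end RightTranslation

/-! ### Means concentrated near the identity -/

section Mean

variable {G : Type v} [MeasurableSpace G] {μ : Measure G}

/-- `f ∈ L¹(G)` is a mean on `V`: it vanishes off `V`, has integral one, and norm at most one. -/
structure IsMean (V : Set G) (f : Lp ℂ 1 μ) : Prop where
  eq_zero : ∀ᵐ s ∂μ, s ∉ V → f s = 0
  integral_eq_one : ∫ s, f s ∂μ = 1
  norm_le_one : ‖f‖ ≤ 1

theorem IsMean.mono {V W : Set G} {f : Lp ℂ 1 μ} (hf : IsMean V f) (h : V ⊆ W) : IsMean W f :=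
  ⟨hf.eq_zero.mono fun _ ht hs => ht fun hV => hs (h hV), hf.2, hf.3⟩

variable {E : Type u} [NormedAddCommGroup E] [NormedSpace ℂ E]

theorem norm_integral_smul_le_of_eq_zero_off {V : Set G} {f : Lp ℂ 1 μ}
    (hf : ∀ᵐ s ∂μ, s ∉ V → f s = 0) {F : G → E} {δ : ℝ} (hF : ∀ s ∈ V, ‖F s‖ ≤ δ) :
    ‖∫ s, f s • F s ∂μ‖ ≤ ‖f‖ * δ := by
  have hi : Integrable (fun s => ‖f s‖ * δ) μ := (L1.integrable_coeFn f).norm.mul_const δ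
  refine (norm_integral_le_of_norm_le hi ?_).trans_eq ?_
  · filter_upwards [hf] with s hs
    by_cases hV : s ∈ V
    · rw [norm_smul]
      exact mul_le_mul_of_nonneg_left (hF s hV) (norm_nonneg _)
    · simp [hs hV]
  · rw [integral_mul_const, ← L1.norm_eq_integral_norm]

theorem IsMean.norm_integral_le {V : Set G} {f : Lp ℂ 1 μ} (hf : IsMean V f) {F : G → E} {δ : ℝ}
    (hδ : 0 ≤ δ) (hF : ∀ s ∈ V, ‖F s‖ ≤ δ) : ‖∫ s, f s • F s ∂μ‖ ≤ δ :=
  (norm_integral_smul_le_of_eq_zero_off hf.eq_zero hF).trans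
    (mul_le_of_le_one_left hδ hf.norm_le_one)

variable [Group G] [TopologicalSpace G] [LocallyCompactSpace G] [BorelSpace G]
  [μ.IsHaarMeasure]

theorem exists_isMean {V : Set G} (hV : V ∈ 𝓝 (1 : G)) : ∃ f : Lp ℂ 1 μ, IsMean V f := by
  obtain ⟨K, hK, hK1⟩ := exists_compact_mem_nhds (1 : G)
  let U := interior (V ∩ K)
  have hU1 : (1 : G) ∈ U := mem_interior_iff_mem_nhds.mpr (inter_mem hV hK1)
  have hUV : U ⊆ V := interior_subset.trans Set.inter_subset_left
  have hUm : MeasurableSet U := isOpen_interior.measurableSet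
  have hUt : μ U ≠ ⊤ :=
    (measure_mono (interior_subset.trans Set.inter_subset_right)).trans_lt hK.measure_lt_top |>.ne
  have hU0 : μ.real U ≠ 0 :=
    (ENNReal.toReal_pos (isOpen_interior.measure_pos μ ⟨1, hU1⟩).ne' hUt).ne'
  have hc : (μ.real U : ℂ) ≠ 0 := by exact_mod_cast hU0
  have hae := indicatorConstLp_coeFn (p := 1) (hs := hUm) (hμs := hUt) (c := (μ.real U : ℂ)⁻¹)
  refine ⟨indicatorConstLp 1 hUm hUt (μ.real U : ℂ)⁻¹, ?_, ?_, ?_⟩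
  · filter_upwards [hae] with s hs hsV
    rw [hs, Set.indicator_of_notMem fun h => hsV (hUV h)]
  · rw [integral_indicatorConstLp, Complex.real_smul, mul_inv_cancel₀ hc]
  · rw [norm_indicatorConstLp one_ne_zero ENNReal.one_ne_top]
    simp [hU0, abs_of_nonneg measureReal_nonneg]

variable [IsTopologicalGroup G] [μ.Regular]

theorem IsMean.norm_integrated_sub_le [CompleteSpace E] {V : Set G} {f : Lp ℂ 1 μ}
    (hf : IsMean V f) (π : IsometricRep G E) {x : E} {δ : ℝ} (hδ : 0 ≤ δ)
    (h : ∀ s ∈ V, ‖π.toHom s x - x‖ ≤ δ) : ‖π.integrated μ f x - x‖ ≤ δ := by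
  have h1 : π.integrated μ f x - x = ∫ s, f s • (π.toHom s x - x) ∂μ := by
    simp only [smul_sub]
    rw [integral_sub (π.integrable_smul f x) ((L1.integrable_coeFn f).smul_const x),
      integral_smul_const, hf.integral_eq_one, one_smul, π.integrated_apply]
  rw [h1]
  exact hf.norm_integral_le hδ h

end Mean

/-! ### The image of `L¹(G)` and of `G` in the pseudofunction algebra -/

namespace SymmPseudo

variable {G : Type v} [Group G] [TopologicalSpace G] [IsTopologicalGroup G]
  [LocallyCompactSpace G] [MeasurableSpace G] [BorelSpace G]
  (R : Set (BanachRep.{u, v} G)) (μ : Measure G) [μ.IsHaarMeasure] [μ.Regular]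

/-- The canonical contraction from `L¹(G)`, with its own norm, to the pseudofunction algebra. -/
noncomputable def ofL1 : Lp ℂ 1 μ →L[ℂ] SymmPseudo R μ :=
  LinearMap.mkContinuous ((of R μ).toLinearMap ∘ₗ (PrePseudo.toL1 R μ).symm.toLinearMap) 1
    fun f => by
      change ‖of R μ ((PrePseudo.toL1 R μ).symm f)‖ ≤ _
      rw [LinearIsometry.norm_map, one_mul]
      exact symmNorm_le (norm_nonneg _) fun ρ _ => ρ.rep.norm_integrated_le f

variable {R μ}

theorem norm_ofL1 (f : Lp ℂ 1 μ) : ‖ofL1 R μ f‖ = symmNorm R μ f :=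
  (of R μ).norm_map _

theorem norm_ofL1_le (f : Lp ℂ 1 μ) : ‖ofL1 R μ f‖ ≤ ‖f‖ := by
  rw [norm_ofL1]
  exact symmNorm_le (norm_nonneg _) fun ρ _ => ρ.rep.norm_integrated_le f

theorem denseRange_ofL1 : DenseRange (ofL1 R μ) := denseRange_of R μ

theorem ofL1_conv (f g : Lp ℂ 1 μ) :
    ofL1 R μ (convL1 μ f g) = ofL1 R μ f * ofL1 R μ g :=
  of_mul R μ ((PrePseudo.toL1 R μ).symm f) ((PrePseudo.toL1 R μ).symm g)

theorem norm_ofL1_le_of_forall {f : Lp ℂ 1 μ} {C : ℝ} (hC : 0 ≤ C)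
    (h : ∀ ρ : BanachRep.{u, v} G, ∀ x : ρ.space, ‖ρ.rep.integrated μ f x‖ ≤ C * ‖x‖) :
    ‖ofL1 R μ f‖ ≤ C := by
  rw [norm_ofL1]
  exact symmNorm_le hC fun ρ _ => ContinuousLinearMap.opNorm_le_bound _ hC (h ρ)

/-- Elements of the algebra coming from `L¹(G)` are equal if no representation separates them. -/
theorem ofL1_eq {f g : Lp ℂ 1 μ}
    (h : ∀ ρ : BanachRep.{u, v} G, ∀ x : ρ.space,
      ρ.rep.integrated μ f x = ρ.rep.integrated μ g x) :
    ofL1 R μ f = ofL1 R μ g := by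
  rw [← sub_eq_zero, ← map_sub, ← norm_le_zero_iff]
  refine norm_ofL1_le_of_forall le_rfl fun ρ x => ?_
  rw [map_sub, sub_apply, h, sub_self, norm_zero, zero_mul]

theorem hom_ext {F : Type*} [NormedAddCommGroup F] [NormedSpace ℂ F]
    {S T : SymmPseudo R μ →L[ℂ] F} (h : ∀ f, S (ofL1 R μ f) = T (ofL1 R μ f)) : S = T :=
  ContinuousLinearMap.coeFn_injective
    (denseRange_ofL1.equalizer S.continuous T.continuous (funext h))

/-! #### Translations as multipliers -/

theorem norm_ofL1_leftRegular_le (s : G) (f : Lp ℂ 1 μ) :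
    ‖ofL1 R μ ((leftRegular μ).toHom s f)‖ ≤ 1 * ‖ofL1 R μ f‖ := by
  rw [one_mul, norm_ofL1, norm_ofL1]
  refine symmNorm_le (symmNorm_nonneg _) fun ρ hρ =>
    ContinuousLinearMap.opNorm_le_bound _ (symmNorm_nonneg _) fun x => ?_
  rw [ρ.rep.integrated_leftRegular, LinearIsometryEquiv.norm_map]
  exact (ρ.rep.integrated μ f).le_of_opNorm_le (le_symmNorm hρ f) x

theorem norm_ofL1_rightTranslate_le (s : G) (f : Lp ℂ 1 μ) :
    ‖ofL1 R μ (_root_.rightTranslate μ s f)‖ ≤ 1 * ‖ofL1 R μ f‖ := by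
  rw [one_mul, norm_ofL1, norm_ofL1]
  refine symmNorm_le (symmNorm_nonneg _) fun ρ hρ =>
    ContinuousLinearMap.opNorm_le_bound _ (symmNorm_nonneg _) fun x => ?_
  rw [ρ.rep.integrated_rightTranslate]
  simpa using (ρ.rep.integrated μ f).le_of_opNorm_le (le_symmNorm hρ f) (ρ.rep.toHom s x)

variable (R μ)

/-- Left translation `a ↦ δ_s a`, extended from `L¹(G)`. -/
noncomputable def leftTranslate (s : G) : SymmPseudo R μ →L[ℂ] SymmPseudo R μ :=
  LinearMap.extendOfNorm ((ofL1 R μ).toLinearMap ∘ₗ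
    ((leftRegular μ).toHom s).toLinearEquiv.toLinearMap) (ofL1 R μ).toLinearMap

/-- Right translation `a ↦ a δ_s`, extended from `L¹(G)`. -/
noncomputable def rightTranslate (s : G) : SymmPseudo R μ →L[ℂ] SymmPseudo R μ :=
  LinearMap.extendOfNorm ((ofL1 R μ).toLinearMap ∘ₗ _root_.rightTranslate μ s)
    (ofL1 R μ).toLinearMap

variable {R μ}

theorem leftTranslate_ofL1 (s : G) (f : Lp ℂ 1 μ) :
    leftTranslate R μ s (ofL1 R μ f) = ofL1 R μ ((leftRegular μ).toHom s f) :=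
  LinearMap.extendOfNorm_eq denseRange_ofL1 ⟨1, norm_ofL1_leftRegular_le s⟩ f

theorem rightTranslate_ofL1 (s : G) (f : Lp ℂ 1 μ) :
    rightTranslate R μ s (ofL1 R μ f) = ofL1 R μ (_root_.rightTranslate μ s f) :=
  LinearMap.extendOfNorm_eq denseRange_ofL1 ⟨1, norm_ofL1_rightTranslate_le s⟩ f

theorem norm_leftTranslate_le (s : G) : ‖leftTranslate R μ s‖ ≤ 1 :=
  LinearMap.opNorm_extendOfNorm_le denseRange_ofL1 zero_le_one (norm_ofL1_leftRegular_le s)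

theorem norm_rightTranslate_le (s : G) : ‖rightTranslate R μ s‖ ≤ 1 :=
  LinearMap.opNorm_extendOfNorm_le denseRange_ofL1 zero_le_one (norm_ofL1_rightTranslate_le s)

theorem leftTranslate_one : leftTranslate R μ 1 = ContinuousLinearMap.id ℂ _ :=
  hom_ext fun f => by rw [leftTranslate_ofL1, map_one]; rfl

theorem rightTranslate_one : rightTranslate R μ 1 = ContinuousLinearMap.id ℂ _ :=
  hom_ext fun f => by
    rw [rightTranslate_ofL1]
    refine ofL1_eq fun ρ x => ?_
    rw [ρ.rep.integrated_rightTranslate, map_one]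
    rfl

theorem leftTranslate_mul (s t : G) :
    leftTranslate R μ (s * t) = (leftTranslate R μ s).comp (leftTranslate R μ t) :=
  hom_ext fun f => by
    rw [ContinuousLinearMap.comp_apply, leftTranslate_ofL1, leftTranslate_ofL1,
      leftTranslate_ofL1, map_mul]
    rfl

theorem rightTranslate_mul (s t : G) :
    rightTranslate R μ (s * t) = (rightTranslate R μ t).comp (rightTranslate R μ s) :=
  hom_ext fun f => by
    rw [ContinuousLinearMap.comp_apply, rightTranslate_ofL1, rightTranslate_ofL1,
      rightTranslate_ofL1]
    refine ofL1_eq fun ρ x => ?_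
    rw [ρ.rep.integrated_rightTranslate, ρ.rep.integrated_rightTranslate,
      ρ.rep.integrated_rightTranslate, map_mul]
    rfl

theorem continuous_leftTranslate (a : SymmPseudo R μ) :
    Continuous fun s : G => leftTranslate R μ s a := by
  refine continuous_of_dense_span norm_leftTranslate_le
    (denseRange_ofL1.mono Submodule.subset_span) ?_ a
  rintro _ ⟨f, rfl⟩
  simp only [leftTranslate_ofL1]
  exact (ofL1 R μ).continuous.comp ((leftRegular μ).continuous_apply f)

theorem continuous_rightTranslate (a : SymmPseudo R μ) :
    Continuous fun s : G => rightTranslate R μ s a := by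
  refine continuous_of_dense_span norm_rightTranslate_le
    (denseRange_ofL1.mono Submodule.subset_span) ?_ a
  rintro _ ⟨f, rfl⟩
  simp only [rightTranslate_ofL1]
  exact (ofL1 R μ).continuous.comp (_root_.continuous_rightTranslate f)

theorem rightTranslate_mul_eq (s : G) (a b : SymmPseudo R μ) :
    rightTranslate R μ s a * b = a * leftTranslate R μ s b := by
  have h : ((ContinuousLinearMap.mul ℂ (SymmPseudo R μ)).flip b).comp (rightTranslate R μ s) =
      (ContinuousLinearMap.mul ℂ (SymmPseudo R μ)).flip (leftTranslate R μ s b) := by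
    refine hom_ext fun f => ?_
    have h' : (ContinuousLinearMap.mul ℂ (SymmPseudo R μ) (rightTranslate R μ s (ofL1 R μ f))) =
        (ContinuousLinearMap.mul ℂ (SymmPseudo R μ) (ofL1 R μ f)).comp (leftTranslate R μ s) := by
      refine hom_ext fun g => ?_
      simp only [ContinuousLinearMap.comp_apply, ContinuousLinearMap.mul_apply']
      rw [rightTranslate_ofL1, leftTranslate_ofL1, ← ofL1_conv, ← ofL1_conv]
      refine ofL1_eq fun ρ x => ?_
      rw [ρ.rep.integrated_conv, ρ.rep.integrated_conv, ContinuousLinearMap.comp_apply,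
        ContinuousLinearMap.comp_apply, ρ.rep.integrated_rightTranslate,
        ρ.rep.integrated_leftRegular]
    exact DFunLike.congr_fun h' b
  exact DFunLike.congr_fun h a

variable (R μ)

/-- The multiplier `δ_s` given by the translations by `s`. -/
noncomputable def dirac (s : G) : 𝓜(ℂ, SymmPseudo R μ) where
  toProd := (leftTranslate R μ s, rightTranslate R μ s)
  central := rightTranslate_mul_eq s

theorem continuous_dirac :
    Continuous[_, strictTopology (SymmPseudo R μ)] (dirac R μ) :=
  continuous_induced_rng.mpr (continuous_pi fun a =>
    (continuous_leftTranslate a).prodMk (continuous_rightTranslate a))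

/-! #### A contractive approximate unit -/

/-- The filter on the algebra generated by the means on small neighbourhoods of the identity. -/
def approxUnit : Filter (SymmPseudo R μ) :=
  (𝓝 (1 : G)).lift' fun V => ofL1 R μ '' Set.ofPred (IsMean V)

variable {R μ}

theorem eventually_approxUnit {p : SymmPseudo R μ → Prop} :
    (∀ᶠ e in approxUnit R μ, p e) ↔
      ∃ V ∈ 𝓝 (1 : G), ∀ f : Lp ℂ 1 μ, IsMean V f → p (ofL1 R μ f) := by
  have h := mem_lift'_sets (f := 𝓝 (1 : G))
    (h := fun V => ofL1 R μ '' Set.ofPred (IsMean V))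
    (fun V W hVW => Set.image_mono fun f (hf : IsMean V f) => hf.mono hVW)
    (s := Set.ofPred p)
  refine h.trans (exists_congr fun V => and_congr_right fun _ => ?_)
  exact Set.image_subset_iff

instance : (approxUnit R μ).NeBot := by
  refine ⟨fun h => ?_⟩
  have h0 : ∀ᶠ _ in approxUnit R μ, False := by rw [h]; exact eventually_bot
  obtain ⟨V, hV, hf⟩ := eventually_approxUnit.mp h0
  obtain ⟨f, hfV⟩ := exists_isMean (μ := μ) hV
  exact hf f hfV

theorem eventually_norm_le_one : ∀ᶠ e in approxUnit R μ, ‖e‖ ≤ 1 :=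
  eventually_approxUnit.mpr
    ⟨Set.univ, univ_mem, fun f hf => (norm_ofL1_le f).trans hf.norm_le_one⟩

theorem tendsto_approxUnit_mul (a : SymmPseudo R μ) :
    Tendsto (fun e => e * a) (approxUnit R μ) (𝓝 a) := by
  refine tendsto_of_dense_span (T := fun e => ContinuousLinearMap.mul ℂ (SymmPseudo R μ) e)
    (S := ContinuousLinearMap.id ℂ _) (C := 1)
    (eventually_norm_le_one.mono fun e he =>
      (ContinuousLinearMap.opNorm_mul_apply_le _ _ _).trans he)
    (denseRange_ofL1.mono Submodule.subset_span) ?_ a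
  rintro _ ⟨g, rfl⟩
  rw [Metric.tendsto_nhds]
  intro ε hε
  have hc : Tendsto (fun s : G => (leftRegular μ).toHom s g) (𝓝 1) (𝓝 g) := by
    simpa using ((leftRegular μ).continuous_apply g).tendsto 1
  refine eventually_approxUnit.mpr
    ⟨_, Metric.tendsto_nhds.mp hc (ε / 2) (half_pos hε), fun f hf => ?_⟩
  rw [ContinuousLinearMap.mul_apply', ← ofL1_conv, dist_eq_norm, ContinuousLinearMap.id_apply,
    ← map_sub]
  refine ((norm_ofL1_le _).trans ?_).trans_lt (half_lt_self hε)
  refine hf.norm_integrated_sub_le (leftRegular μ) (half_pos hε).le fun s hs => ?_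
  rw [← dist_eq_norm]
  exact le_of_lt hs

theorem tendsto_mul_approxUnit (a : SymmPseudo R μ) :
    Tendsto (fun e => a * e) (approxUnit R μ) (𝓝 a) := by
  refine tendsto_of_dense_span
    (T := fun e => (ContinuousLinearMap.mul ℂ (SymmPseudo R μ)).flip e)
    (S := ContinuousLinearMap.id ℂ _) (C := 1)
    (eventually_norm_le_one.mono fun e he => ?_)
    (denseRange_ofL1.mono Submodule.subset_span) ?_ a
  · refine ContinuousLinearMap.opNorm_le_bound _ zero_le_one fun a => ?_
    rw [ContinuousLinearMap.flip_apply, ContinuousLinearMap.mul_apply', one_mul]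
    exact (norm_mul_le _ _).trans (mul_le_of_le_one_right (norm_nonneg _) he)
  rintro _ ⟨g, rfl⟩
  rw [Metric.tendsto_nhds]
  intro ε hε
  have hc : Tendsto (fun s : G => _root_.rightTranslate μ s g) (𝓝 1)
      (𝓝 (_root_.rightTranslate μ 1 g)) := (_root_.continuous_rightTranslate g).tendsto 1
  refine eventually_approxUnit.mpr
    ⟨_, Metric.tendsto_nhds.mp hc (ε / 2) (half_pos hε), fun f hf => ?_⟩
  have h1 : ofL1 R μ g = ofL1 R μ (_root_.rightTranslate μ 1 g) := by
    rw [← rightTranslate_ofL1, rightTranslate_one]; rfl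
  rw [ContinuousLinearMap.flip_apply, ContinuousLinearMap.mul_apply', ← ofL1_conv, dist_eq_norm,
    ContinuousLinearMap.id_apply, h1, ← map_sub]
  refine lt_of_le_of_lt ?_ (half_lt_self hε)
  refine norm_ofL1_le_of_forall (half_pos hε).le fun ρ x => ?_
  -- `π(g * f) - π(g)` is the integral of `f(s) (π(g * δ_s) - π(g * δ_1))`
  have h2 : ρ.rep.integrated μ (convL1 μ g f - _root_.rightTranslate μ 1 g) x =
      ∫ s, f s • ρ.rep.integrated μ
        (_root_.rightTranslate μ s g - _root_.rightTranslate μ 1 g) x ∂μ := by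
    simp only [map_sub, sub_apply, ρ.rep.integrated_rightTranslate, smul_sub]
    have hi : Integrable (fun s => f s • ρ.rep.integrated μ g (ρ.rep.toHom s x)) μ := by
      simpa using (ρ.rep.integrated μ g).integrable_comp (ρ.rep.integrable_smul f x)
    rw [integral_sub hi ((L1.integrable_coeFn f).smul_const _), integral_smul_const,
      hf.integral_eq_one, one_smul, ρ.rep.integrated_conv, ContinuousLinearMap.comp_apply,
      ρ.rep.integrated_apply f, ← ContinuousLinearMap.integral_comp_comm _
        (ρ.rep.integrable_smul f x)]
    simp
  rw [h2]
  refine hf.norm_integral_le (by positivity) fun s hs => ?_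
  refine (ContinuousLinearMap.le_opNorm _ _).trans
    (mul_le_mul_of_nonneg_right ((ρ.rep.norm_integrated_le _).trans ?_) (norm_nonneg _))
  rw [← dist_eq_norm]
  exact le_of_lt hs

theorem isApproximateUnit_approxUnit : (approxUnit R μ).IsApproximateUnit where
  tendsto_mul_left := tendsto_mul_approxUnit
  tendsto_mul_right := tendsto_approxUnit_mul

theorem hasBoundedApproxUnit : HasBoundedApproxUnit (SymmPseudo R μ) :=
  ⟨approxUnit R μ, isApproximateUnit_approxUnit, 1, eventually_norm_le_one⟩

end SymmPseudo

/-! ### Isometric representations and almost invariant nets -/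

namespace IsometricRep

variable {G : Type v} [Group G] [TopologicalSpace G]
variable {E : Type u} [NormedAddCommGroup E] [NormedSpace ℂ E]

theorem map_one_apply (π : IsometricRep G E) (x : E) : π.toHom 1 x = x := by
  rw [map_one]; rfl

theorem map_mul_apply (π : IsometricRep G E) (s t : G) (x : E) :
    π.toHom (s * t) x = π.toHom s (π.toHom t x) := by
  rw [map_mul]; rfl

/-- A homomorphism into the contractions of `E` which is strongly continuous on a set with dense
span is a continuous isometric representation. -/
def ofContractions (T : G → E →L[ℂ] E) (h1 : T 1 = ContinuousLinearMap.id ℂ E)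
    (hmul : ∀ s t, T (s * t) = (T s).comp (T t)) (hT : ∀ s, ‖T s‖ ≤ 1) {D : Set E}
    (hD : Dense (Submodule.span ℂ D : Set E)) (hc : ∀ x ∈ D, Continuous fun s => T s x) :
    IsometricRep G E where
  toHom :=
    { toFun := fun s =>
        { toFun := T s
          invFun := T s⁻¹
          map_add' := map_add (T s)
          map_smul' := map_smul (T s)
          left_inv := fun x => by
            rw [← ContinuousLinearMap.comp_apply, ← hmul, inv_mul_cancel, h1]; rfl
          right_inv := fun x => by
            rw [← ContinuousLinearMap.comp_apply, ← hmul, mul_inv_cancel, h1]; rfl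
          norm_map' := fun x => by
            refine le_antisymm (by simpa using (T s).le_of_opNorm_le (hT s) x) ?_
            have h : T s⁻¹ (T s x) = x := by
              rw [← ContinuousLinearMap.comp_apply, ← hmul, inv_mul_cancel, h1]; rfl
            have h' := (T s⁻¹).le_of_opNorm_le (hT s⁻¹) (T s x)
            rw [h, one_mul] at h'
            exact h' }
      map_one' := by
        ext x
        change T 1 x = x
        rw [h1]; rfl
      map_mul' := fun s t => by
        ext x
        change T (s * t) x = T s (T t x)
        rw [hmul]; rfl }
  continuous_apply := continuous_of_dense_span hT hD hc

/-- The pointwise product of two commuting continuous isometric representations. -/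
def mulOfCommute (σ τ : IsometricRep G E)
    (h : ∀ s t x, σ.toHom s (τ.toHom t x) = τ.toHom t (σ.toHom s x)) : IsometricRep G E where
  toHom :=
    { toFun := fun s => σ.toHom s * τ.toHom s
      map_one' := by simp
      map_mul' := fun s t => by
        ext x
        change σ.toHom (s * t) (τ.toHom (s * t) x) =
          σ.toHom s (τ.toHom s (σ.toHom t (τ.toHom t x)))
        rw [σ.map_mul_apply, τ.map_mul_apply, h t s] }
  continuous_apply := fun x => by
    refine continuous_iff_continuousAt.mpr fun s₀ => ?_
    have h1 := ((σ.continuous_apply (τ.toHom s₀ x)).tendsto s₀)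
    have h2 := tendsto_iff_norm_sub_tendsto_zero.mp ((τ.continuous_apply x).tendsto s₀)
    have h3 : Tendsto (fun s => σ.toHom s (τ.toHom s x) - σ.toHom s (τ.toHom s₀ x)) (𝓝 s₀)
        (𝓝 0) := by
      refine tendsto_zero_iff_norm_tendsto_zero.mpr (h2.congr fun s => ?_)
      rw [← map_sub, LinearIsometryEquiv.norm_map]
    simpa using! h3.add h1

/-- A net of vectors which is asymptotically invariant, uniformly on compact subsets of `G`. -/
def IsAlmostInvariant (π : IsometricRep G E) {I : Type*} [Preorder I] (ξ : I → E) : Prop :=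
  ∀ K : Set G, IsCompact K → ∀ ε : ℝ, 0 < ε →
    ∃ i₀, ∀ i, i₀ ≤ i → ∀ s ∈ K, ‖π.toHom s (ξ i) - ξ i‖ < ε

theorem mem_invariants (π : IsometricRep G E) {x : E} :
    x ∈ π.toRepresentation.invariants ↔ ∀ s, π.toHom s x = x := Iff.rfl

theorem isClosed_invariants (π : IsometricRep G E) :
    IsClosed (π.toRepresentation.invariants : Set E) := by
  have h : (π.toRepresentation.invariants : Set E) = ⋂ s, Set.ofPred fun x => π.toHom s x = x := by
    ext x
    rw [Set.mem_iInter]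
    exact π.mem_invariants
  rw [h]
  exact isClosed_iInter fun s => isClosed_eq (π.toHom s).continuous continuous_id

theorem quotientRep_mk_sub (π : IsometricRep G E) (s : G) (x : E) :
    π.quotientRep s (Submodule.Quotient.mk x) - Submodule.Quotient.mk x =
      Submodule.Quotient.mk (π.toHom s x - x) := rfl

/-- If `E ⧸ E^π` has no almost invariant vectors, then the distance of a vector of `E` to `E^π` is
controlled by its displacement under some compact set. -/
theorem exists_invariant_near (π : IsometricRep G E)
    (h : ¬ HasAlmostInvariantVectors π.quotientRep) :
    ∃ K : Set G, IsCompact K ∧ ∃ ε : ℝ, 0 < ε ∧ ∀ (x : E) (δ : ℝ),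
      (∀ s ∈ K, ‖π.toHom s x - x‖ ≤ δ) → 0 ≤ δ →
        ∃ y ∈ π.toRepresentation.invariants, ε * ‖x - y‖ ≤ 2 * δ := by
  simp only [HasAlmostInvariantVectors, not_forall] at h
  obtain ⟨K, hK, ε, hε, h⟩ := h
  refine ⟨K, hK, ε, hε, fun x δ hx hδ => ?_⟩
  let q : E ⧸ π.toRepresentation.invariants := Submodule.Quotient.mk x
  have : IsClosed (π.toRepresentation.invariants : Set E) := π.isClosed_invariants
  by_cases hq : ‖q‖ = 0
  · refine ⟨x, ?_, by simpa using hδ⟩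
    exact (Submodule.Quotient.mk_eq_zero _).mp (norm_eq_zero.mp hq)
  have hq0 : 0 < ‖q‖ := lt_of_le_of_ne (norm_nonneg _) (Ne.symm hq)
  have hle : ε * ‖q‖ ≤ δ := by
    by_contra hlt
    refine h ⟨(‖q‖⁻¹ : ℂ) • q, by simp [norm_smul, hq], fun s hs => ?_⟩
    rw [map_smul, ← smul_sub, quotientRep_mk_sub, norm_smul, norm_inv, Complex.norm_real,
      norm_norm, inv_mul_lt_iff₀ hq0, mul_comm]
    exact ((Submodule.Quotient.norm_mk_le _ _).trans (hx s hs)).trans_lt (not_le.mp hlt)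
  obtain ⟨m, hm, hml⟩ := Submodule.Quotient.norm_mk_lt q hq0
  refine ⟨x - m, ?_, ?_⟩
  · rw [← Submodule.Quotient.mk_eq_zero, Submodule.Quotient.mk_sub, hm, sub_self]
  · rw [sub_sub_cancel]
    nlinarith

/-- If `E ⧸ E^π` has no almost invariant vectors, then almost invariant nets are asymptotic to nets
of invariant vectors. -/
theorem IsAlmostInvariant.exists_tendsto {π : IsometricRep G E} {I : Type*} [Preorder I]
    [IsDirectedOrder I] [Nonempty I] {ξ : I → E} (hξ : π.IsAlmostInvariant ξ)
    (h : ¬ HasAlmostInvariantVectors π.quotientRep) :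
    ∃ η : I → E, (∀ i, η i ∈ π.toRepresentation.invariants) ∧
      Tendsto (fun i => ‖ξ i - η i‖) atTop (𝓝 0) := by
  obtain ⟨K, hK, ε, hε, hy⟩ := π.exists_invariant_near h
  -- the displacement of `ξ i` under `K`; it is a supremum of a bounded set
  have hbdd : ∀ x : E, BddAbove (Set.range fun s : K => ‖π.toHom s x - x‖) := by
    rintro x
    refine ⟨‖x‖ + ‖x‖, ?_⟩
    rintro _ ⟨s, rfl⟩
    exact (norm_sub_le _ _).trans_eq (by rw [LinearIsometryEquiv.norm_map])
  let d : E → ℝ := fun x => ⨆ s : K, ‖π.toHom s x - x‖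
  have hd : ∀ x, ∀ s ∈ K, ‖π.toHom s x - x‖ ≤ d x := fun x s hs => le_ciSup (hbdd x) ⟨s, hs⟩
  have hd0 : ∀ x, 0 ≤ d x := fun x => Real.iSup_nonneg fun _ => norm_nonneg _
  choose η hη hle using fun i => hy (ξ i) (d (ξ i)) (hd _) (hd0 _)
  refine ⟨η, hη, Metric.tendsto_nhds.mpr fun δ hδ => ?_⟩
  obtain ⟨i₀, hi₀⟩ := hξ K hK (ε * δ / 4) (by positivity)
  filter_upwards [eventually_ge_atTop i₀] with i hi
  have h1 : d (ξ i) ≤ ε * δ / 4 := Real.iSup_le (fun s => (hi₀ i hi s s.2).le) (by positivity)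
  rw [Real.dist_eq, sub_zero, abs_norm]
  have h2 := hle i
  by_contra hc
  nlinarith

end IsometricRep

/-! ### The representations of `G` on an essential bimodule -/

namespace BanachBimodule

section Multipliers

variable {A : Type v} [NonUnitalNormedRing A] [NormedSpace ℂ A]
variable {E : Type u} [NormedAddCommGroup E] [NormedSpace ℂ E] {M : BanachBimodule A E}

theorem IsEssential.dense_left (hM : M.IsEssential) : Dense (Submodule.span ℂ
    (Set.ofPred fun η : E => ∃ (a : A) (ξ : E), η = M.left a ξ) : Set E) := by
  refine hM.mono (Submodule.span_mono ?_)
  rintro _ ⟨a, b, ξ, rfl⟩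
  exact ⟨a, M.right b ξ, (M.comm a b ξ).symm⟩

theorem IsEssential.dense_right (hM : M.IsEssential) : Dense (Submodule.span ℂ
    (Set.ofPred fun η : E => ∃ (a : A) (ξ : E), η = M.right a ξ) : Set E) := by
  refine hM.mono (Submodule.span_mono ?_)
  rintro _ ⟨a, b, ξ, rfl⟩
  exact ⟨b, M.left a ξ, rfl⟩

variable (M) in
/-- The left action as a bounded bilinear map. -/
noncomputable def leftL : A →L[ℂ] E →L[ℂ] E := M.left.mkContinuous 1 fun a => by simpa using M.norm_left_le a

variable (M) in
/-- The right action as a bounded bilinear map. -/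
noncomputable def rightL : A →L[ℂ] E →L[ℂ] E := M.right.mkContinuous 1 fun a => by simpa using M.norm_right_le a

@[simp] theorem leftL_apply (a : A) : M.leftL a = M.left a := rfl

@[simp] theorem rightL_apply (a : A) : M.rightL a = M.right a := rfl

variable (M) in
theorem norm_leftL_flip_sub_rightL_flip_le {ξ : E} (hξ : ‖ξ‖ = 1) :
    ‖M.leftL.flip ξ - M.rightL.flip ξ‖ ≤ 2 := by
  refine ContinuousLinearMap.opNorm_le_bound _ zero_le_two fun a => ?_
  have h2 := (M.left a).le_of_opNorm_le (M.norm_left_le a) ξ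
  have h3 := (M.right a).le_of_opNorm_le (M.norm_right_le a) ξ
  rw [hξ, mul_one] at h2 h3
  exact (norm_sub_le (M.left a ξ) (M.right a ξ)).trans (by linarith)

variable [SMulCommClass ℂ A A] [IsScalarTower ℂ A A]

theorem _root_.continuous_strictTopology_fst (a : A) :
    @Continuous _ _ (strictTopology A) _ fun x : 𝓜(ℂ, A) => x.fst a := by
  have h1 : Continuous fun F : A → A × A => (F a).1 := by fun_prop
  have h2 := @continuous_induced_dom _ _
    (fun x : 𝓜(ℂ, A) => fun a : A => (x.fst a, x.snd a)) Pi.topologicalSpace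
  exact @Continuous.comp _ _ _ (strictTopology A) _ _ _ _ h1 h2

variable [CompleteSpace E]

theorem IsEssential.leftMult_left (hM : M.IsEssential) (hA : HasBoundedApproxUnit A) (x : 𝓜(ℂ, A))
    (a : A) (ξ : E) : M.leftMult x (M.left a ξ) = M.left (x.fst a) ξ := by
  have h := (M.existsUnique_isLeftExtension hA hM x).exists
  rw [leftMult, dif_pos h]
  exact h.choose_spec a ξ

theorem IsEssential.rightMult_right (hM : M.IsEssential) (hA : HasBoundedApproxUnit A)
    (x : 𝓜(ℂ, A)) (a : A) (ξ : E) : M.rightMult x (M.right a ξ) = M.right (x.snd a) ξ := by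
  have h := (M.existsUnique_isRightExtension hA hM x).exists
  rw [rightMult, dif_pos h]
  exact h.choose_spec a ξ

theorem IsEssential.leftMult_rightMult_comm (hM : M.IsEssential) (hA : HasBoundedApproxUnit A)
    (x y : 𝓜(ℂ, A)) (ξ : E) :
    M.leftMult x (M.rightMult y ξ) = M.rightMult y (M.leftMult x ξ) := by
  have h : (M.leftMult x).comp (M.rightMult y) = (M.rightMult y).comp (M.leftMult x) := by
    refine ContinuousLinearMap.ext_on hM ?_
    rintro _ ⟨a, b, ξ, rfl⟩
    simp only [ContinuousLinearMap.comp_apply]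
    rw [hM.rightMult_right hA, ← M.comm, hM.leftMult_left hA, ← M.comm, hM.leftMult_left hA,
      M.comm, M.comm, hM.rightMult_right hA]
  exact DFunLike.congr_fun h ξ

/-- `(ξ · x) · b = ξ · L(b)` for a multiplier `x = (L, R)`. -/
theorem IsEssential.right_rightMult (hM : M.IsEssential) (hA : HasBoundedApproxUnit A)
    (x : 𝓜(ℂ, A)) (b : A) (ξ : E) : M.right b (M.rightMult x ξ) = M.right (x.fst b) ξ := by
  have h : (M.right b).comp (M.rightMult x) = M.right (x.fst b) := by
    refine ContinuousLinearMap.ext_on hM.dense_right ?_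
    rintro _ ⟨a, ξ, rfl⟩
    rw [ContinuousLinearMap.comp_apply, hM.rightMult_right hA, ← M.right_mul, x.central,
      M.right_mul]
  exact DFunLike.congr_fun h ξ

end Multipliers

section Group

open SymmPseudo

variable {G : Type v} [Group G] [TopologicalSpace G] [IsTopologicalGroup G]
  [LocallyCompactSpace G] [MeasurableSpace G] [BorelSpace G]
  {R : Set (BanachRep.{u, v} G)} {μ : Measure G} [μ.IsHaarMeasure] [μ.Regular]
variable {E : Type u} [NormedAddCommGroup E] [NormedSpace ℂ E]
  {M : BanachBimodule (SymmPseudo R μ) E}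

theorem IsEssential.tendsto_left (hM : M.IsEssential) (ξ : E) :
    Tendsto (fun e => M.left e ξ) (approxUnit R μ) (𝓝 ξ) := by
  refine tendsto_of_dense_span (S := ContinuousLinearMap.id ℂ E)
    (eventually_norm_le_one.mono fun e he => (M.norm_left_le e).trans he) hM.dense_left ?_ ξ
  rintro _ ⟨a, ζ, rfl⟩
  simp only [← M.left_mul]
  exact ((M.leftL.flip ζ).continuous.tendsto a).comp (tendsto_approxUnit_mul a)

theorem IsEssential.tendsto_right (hM : M.IsEssential) (ξ : E) :
    Tendsto (fun e => M.right e ξ) (approxUnit R μ) (𝓝 ξ) := by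
  refine tendsto_of_dense_span (S := ContinuousLinearMap.id ℂ E)
    (eventually_norm_le_one.mono fun e he => (M.norm_right_le e).trans he) hM.dense_right ?_ ξ
  rintro _ ⟨a, ζ, rfl⟩
  simp only [← M.right_mul]
  exact ((M.rightL.flip ζ).continuous.tendsto a).comp (tendsto_mul_approxUnit a)

variable [CompleteSpace E]

theorem IsEssential.norm_leftMult_dirac_le (hM : M.IsEssential) (s : G) :
    ‖M.leftMult (dirac R μ s)‖ ≤ 1 := by
  refine ContinuousLinearMap.opNorm_le_bound _ zero_le_one fun ξ => ?_
  refine le_of_tendsto (((M.leftMult (dirac R μ s)).continuous.tendsto ξ).comp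
    (hM.tendsto_left ξ)).norm (eventually_norm_le_one.mono fun e he => ?_)
  rw [Function.comp_apply, hM.leftMult_left hasBoundedApproxUnit]
  refine (M.left _).le_of_opNorm_le ((M.norm_left_le _).trans ?_) ξ
  exact ((leftTranslate R μ s).le_of_opNorm_le (norm_leftTranslate_le s) e).trans (by simpa)

theorem IsEssential.norm_rightMult_dirac_le (hM : M.IsEssential) (s : G) :
    ‖M.rightMult (dirac R μ s)‖ ≤ 1 := by
  refine ContinuousLinearMap.opNorm_le_bound _ zero_le_one fun ξ => ?_
  refine le_of_tendsto (((M.rightMult (dirac R μ s)).continuous.tendsto ξ).comp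
    (hM.tendsto_right ξ)).norm (eventually_norm_le_one.mono fun e he => ?_)
  rw [Function.comp_apply, hM.rightMult_right hasBoundedApproxUnit]
  refine (M.right _).le_of_opNorm_le ((M.norm_right_le _).trans ?_) ξ
  exact ((rightTranslate R μ s).le_of_opNorm_le (norm_rightTranslate_le s) e).trans (by simpa)

/-- The representation `ξ ↦ δ_s · ξ` on an essential bimodule. -/
noncomputable def leftRep (M : BanachBimodule (SymmPseudo R μ) E) (hM : M.IsEssential) : IsometricRep G E :=
  IsometricRep.ofContractions (fun s => M.leftMult (dirac R μ s))
    (ContinuousLinearMap.ext_on hM.dense_left (by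
      rintro _ ⟨a, ξ, rfl⟩
      rw [hM.leftMult_left hasBoundedApproxUnit]
      change M.left (leftTranslate R μ 1 a) ξ = _
      rw [leftTranslate_one]; rfl))
    (fun s t => ContinuousLinearMap.ext_on hM.dense_left (by
      rintro _ ⟨a, ξ, rfl⟩
      simp only [ContinuousLinearMap.comp_apply, hM.leftMult_left hasBoundedApproxUnit]
      change M.left (leftTranslate R μ (s * t) a) ξ = _
      rw [leftTranslate_mul]; rfl))
    hM.norm_leftMult_dirac_le hM.dense_left (by
      rintro _ ⟨a, ξ, rfl⟩
      simp only [hM.leftMult_left hasBoundedApproxUnit]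
      exact (M.leftL.flip ξ).continuous.comp (continuous_leftTranslate a))

/-- The representation `ξ ↦ ξ · δ_{s⁻¹}` on an essential bimodule. -/
noncomputable def rightRep (M : BanachBimodule (SymmPseudo R μ) E) (hM : M.IsEssential) : IsometricRep G E :=
  IsometricRep.ofContractions (fun s => M.rightMult (dirac R μ s⁻¹))
    (ContinuousLinearMap.ext_on hM.dense_right (by
      rintro _ ⟨a, ξ, rfl⟩
      rw [hM.rightMult_right hasBoundedApproxUnit, inv_one]
      change M.right (rightTranslate R μ 1 a) ξ = _
      rw [rightTranslate_one]; rfl))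
    (fun s t => ContinuousLinearMap.ext_on hM.dense_right (by
      rintro _ ⟨a, ξ, rfl⟩
      simp only [ContinuousLinearMap.comp_apply, hM.rightMult_right hasBoundedApproxUnit,
        mul_inv_rev]
      change M.right (rightTranslate R μ (t⁻¹ * s⁻¹) a) ξ = _
      rw [rightTranslate_mul]; rfl))
    (fun s => hM.norm_rightMult_dirac_le s⁻¹) hM.dense_right (by
      rintro _ ⟨a, ξ, rfl⟩
      simp only [hM.rightMult_right hasBoundedApproxUnit]
      exact (M.rightL.flip ξ).continuous.comp ((continuous_rightTranslate a).comp continuous_inv))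

theorem leftRep_apply (hM : M.IsEssential) (s : G) (ξ : E) :
    (M.leftRep hM).toHom s ξ = M.leftMult (dirac R μ s) ξ := rfl

theorem rightRep_apply (hM : M.IsEssential) (s : G) (ξ : E) :
    (M.rightRep hM).toHom s ξ = M.rightMult (dirac R μ s⁻¹) ξ := rfl

/-- The conjugation representation `ξ ↦ δ_s · ξ · δ_{s⁻¹}` on an essential bimodule. -/
noncomputable def conjRep (M : BanachBimodule (SymmPseudo R μ) E) (hM : M.IsEssential) : IsometricRep G E :=
  (M.leftRep hM).mulOfCommute (M.rightRep hM) fun _ _ ξ =>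
    hM.leftMult_rightMult_comm hasBoundedApproxUnit _ _ ξ

theorem rightRep_rightMult_dirac (hM : M.IsEssential) (s : G) (ξ : E) :
    (M.rightRep hM).toHom s (M.rightMult (dirac R μ s) ξ) = ξ := by
  have h : M.rightMult (dirac R μ s) ξ = (M.rightRep hM).toHom s⁻¹ ξ := by
    rw [rightRep_apply, inv_inv]
  rw [h, ← IsometricRep.map_mul_apply, mul_inv_cancel, IsometricRep.map_one_apply]

theorem norm_conjRep_sub (hM : M.IsEssential) (s : G) (ξ : E) :
    ‖(M.conjRep hM).toHom s ξ - ξ‖ =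
      ‖M.leftMult (dirac R μ s) ξ - M.rightMult (dirac R μ s) ξ‖ := by
  rw [← LinearIsometryEquiv.norm_map ((M.rightRep hM).toHom s)
    (M.leftMult (dirac R μ s) ξ - _), map_sub, rightRep_rightMult_dirac]
  congr 2
  exact hM.leftMult_rightMult_comm hasBoundedApproxUnit _ _ ξ

theorem IsStrictlyAlmostCentral.isAlmostInvariant (hM : M.IsEssential) {I : Type*} [Preorder I]
    {ξ : I → E} (hξ : M.IsStrictlyAlmostCentral ξ) : (M.conjRep hM).IsAlmostInvariant ξ := by
  intro K hK ε hε
  obtain ⟨i₀, hi₀⟩ := hξ (dirac R μ '' K)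
    (@IsCompact.image _ _ _ (strictTopology _) K _ hK (continuous_dirac R μ)) ε hε
  refine ⟨i₀, fun i hi s hs => ?_⟩
  rw [norm_conjRep_sub]
  exact hi₀ i hi _ ⟨s, hs, rfl⟩

/-- The left action of `L¹(G)` is the integrated form of the left action of `G`. -/
theorem left_ofL1 (hM : M.IsEssential) (f : Lp ℂ 1 μ) :
    M.left (ofL1 R μ f) = (M.leftRep hM).integrated μ f := by
  refine ContinuousLinearMap.ext_on hM.dense_left ?_
  rintro _ ⟨a, ζ, rfl⟩
  have h : (M.left (ofL1 R μ f)).comp (M.leftL.flip ζ) =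
      ((M.leftRep hM).integrated μ f).comp (M.leftL.flip ζ) := by
    refine hom_ext fun g => ?_
    simp only [ContinuousLinearMap.comp_apply, ContinuousLinearMap.flip_apply, leftL_apply]
    have h1 := ((M.leftL.flip ζ).comp (ofL1 R μ)).integral_comp_comm
      ((leftRegular μ).integrable_smul f g)
    rw [← M.left_mul, ← ofL1_conv, IsometricRep.integrated_apply]
    refine h1.symm.trans (integral_congr_ae (ae_of_all _ fun s => ?_))
    simp only [map_smul]
    rw [leftRep_apply, hM.leftMult_left hasBoundedApproxUnit]
    change f s • M.left (ofL1 R μ _) ζ = f s • M.left (leftTranslate R μ s _) ζ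
    rw [leftTranslate_ofL1]
  exact DFunLike.congr_fun h a

/-- Vectors invariant under conjugation are central. -/
theorem isCentral_of_mem_invariants (hM : M.IsEssential) {η : E}
    (hη : η ∈ (M.conjRep hM).toRepresentation.invariants) : M.IsCentral η := by
  have hη' : ∀ s, (M.leftRep hM).toHom s η = M.rightMult (dirac R μ s) η := by
    intro s
    have h := norm_conjRep_sub hM s η
    rw [(M.conjRep hM).mem_invariants.mp hη s, sub_self, norm_zero] at h
    exact sub_eq_zero.mp (norm_eq_zero.mp h.symm)
  have key : ∀ f g : Lp ℂ 1 μ, M.right (ofL1 R μ g) (M.left (ofL1 R μ f) η) =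
      M.right (ofL1 R μ g) (M.right (ofL1 R μ f) η) := by
    intro f g
    have h1 := ((M.rightL.flip η).comp (ofL1 R μ)).integral_comp_comm
      ((leftRegular μ).integrable_smul f g)
    rw [← M.right_mul, ← ofL1_conv, left_ofL1 hM, IsometricRep.integrated_apply,
      ← ContinuousLinearMap.integral_comp_comm _ ((M.leftRep hM).integrable_smul f η)]
    refine Eq.trans (integral_congr_ae (ae_of_all _ fun s => ?_)) h1
    simp only [map_smul]
    rw [hη', hM.right_rightMult hasBoundedApproxUnit]
    change f s • M.right (leftTranslate R μ s _) η = f s • M.right (ofL1 R μ _) η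
    rw [leftTranslate_ofL1]
  have h : M.leftL.flip η = M.rightL.flip η := by
    refine hom_ext fun f => ?_
    have h2 : ∀ a, M.right a (M.left (ofL1 R μ f) η) = M.right a (M.right (ofL1 R μ f) η) :=
      DFunLike.congr_fun (f := M.rightL.flip _) (g := M.rightL.flip _) (hom_ext fun g => key f g)
    exact tendsto_nhds_unique ((hM.tendsto_right _).congr h2) (hM.tendsto_right _)
  exact DFunLike.congr_fun h

end Group

end BanachBimodule

/-! ### Almost invariant vectors in a quotient representation -/

namespace IsometricRep

variable {G : Type v} [Group G] [TopologicalSpace G]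
variable {E : Type u} [NormedAddCommGroup E] [NormedSpace ℂ E]

/-- If the displacement `π(s) x - x` is within `δ` of a vector `v` fixed by `π(s)`, then `v` is
small: `π(sⁿ) x - x` is bounded in `n` and within `n δ` of `n v`. -/
theorem norm_le_of_norm_sub_sub_le (π : IsometricRep G E) {s : G} {x v : E} {δ : ℝ}
    (hv : π.toHom s v = v) (h : ‖π.toHom s x - x - v‖ ≤ δ) : ‖v‖ ≤ δ := by
  have hpow : ∀ n : ℕ, π.toHom (s ^ n) v = v := by
    intro n
    induction n with
    | zero => rw [pow_zero, π.map_one_apply]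
    | succ n ih => rw [pow_succ, π.map_mul_apply, hv, ih]
  have hn : ∀ n : ℕ, ‖π.toHom (s ^ n) x - x - n • v‖ ≤ n * δ := by
    intro n
    induction n with
    | zero => simp
    | succ n ih =>
      have h1 : π.toHom (s ^ (n + 1)) x - x - (n + 1) • v =
          π.toHom (s ^ n) (π.toHom s x - x - v) + (π.toHom (s ^ n) x - x - n • v) := by
        rw [map_sub, map_sub, hpow, ← π.map_mul_apply, ← pow_succ, succ_nsmul]
        abel
      rw [h1]
      refine (norm_add_le _ _).trans ?_
      rw [LinearIsometryEquiv.norm_map, Nat.cast_succ, add_mul, one_mul, add_comm]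
      exact add_le_add ih h
  have hb : ∀ n : ℕ, n * (‖v‖ - δ) ≤ ‖x‖ + ‖x‖ := by
    intro n
    have h1 : ‖n • v‖ ≤ ‖π.toHom (s ^ n) x - x‖ + ‖π.toHom (s ^ n) x - x - n • v‖ := by
      refine le_trans (le_of_eq ?_) (norm_sub_le _ _)
      rw [sub_sub_cancel]
    have h2 : ‖π.toHom (s ^ n) x - x‖ ≤ ‖x‖ + ‖x‖ :=
      (norm_sub_le _ _).trans_eq (by rw [LinearIsometryEquiv.norm_map])
    have h3 : ‖n • v‖ = n * ‖v‖ := by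
      rw [← Nat.cast_smul_eq_nsmul ℝ, norm_smul, Real.norm_natCast]
    linarith [hn n]
  by_contra hlt
  have hpos : 0 < ‖v‖ - δ := sub_pos.mpr (not_le.mp hlt)
  obtain ⟨n, hn⟩ := exists_nat_gt ((‖x‖ + ‖x‖) / (‖v‖ - δ))
  rw [div_lt_iff₀ hpos] at hn
  exact absurd (hb n) (not_le.mpr hn)

/-- The displacement of `x` by `s` is at most twice its displacement in `E ⧸ E^π`. -/
theorem norm_sub_lt_of_norm_quotientRep_sub_lt (π : IsometricRep G E) {s : G} {x : E} {δ : ℝ}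
    (h : ‖π.quotientRep s (Submodule.Quotient.mk x) - Submodule.Quotient.mk x‖ < δ) :
    ‖π.toHom s x - x‖ < 2 * δ := by
  rw [quotientRep_mk_sub] at h
  obtain ⟨m, hm, hml⟩ := Submodule.Quotient.norm_mk_lt
    (Submodule.Quotient.mk (π.toHom s x - x) : E ⧸ π.toRepresentation.invariants) (sub_pos.mpr h)
  rw [add_sub_cancel] at hml
  have hv : π.toHom s x - x - m ∈ π.toRepresentation.invariants := by
    rw [← Submodule.Quotient.mk_eq_zero, Submodule.Quotient.mk_sub _ (x := π.toHom s x - x), hm,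
      sub_self]
  have h1 : ‖π.toHom s x - x - m‖ ≤ ‖m‖ :=
    π.norm_le_of_norm_sub_sub_le (π.mem_invariants.mp hv s) (by rw [sub_sub_cancel])
  calc ‖π.toHom s x - x‖ = ‖(π.toHom s x - x - m) + m‖ := by rw [sub_add_cancel]
    _ ≤ ‖π.toHom s x - x - m‖ + ‖m‖ := norm_add_le _ _
    _ < 2 * δ := by linarith

/-- Almost invariant vectors in `E ⧸ E^π` lift to almost invariant unit vectors of `E` at
distance at least `1/2` from `E^π`. -/
theorem exists_lift_of_hasAlmostInvariantVectors (π : IsometricRep G E)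
    (h : HasAlmostInvariantVectors π.quotientRep) {K : Set G} (hK : IsCompact K) {ε : ℝ}
    (hε : 0 < ε) :
    ∃ x : E, ‖x‖ = 1 ∧ (∀ y ∈ π.toRepresentation.invariants, 1 / 2 ≤ ‖x - y‖) ∧
      ∀ s ∈ K, ‖π.toHom s x - x‖ < ε := by
  obtain ⟨q, hq, hqK⟩ := h K hK (ε / 2) (half_pos hε)
  obtain ⟨m, rfl, hm⟩ := Submodule.Quotient.norm_mk_lt q one_pos
  have hm1 : 1 ≤ ‖m‖ := hq ▸ Submodule.Quotient.norm_mk_le _ m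
  have hm0 : 0 < ‖m‖ := one_pos.trans_le hm1
  have hm2 : ‖m‖ < 2 := by linarith
  have hmc : (‖m‖ : ℂ) ≠ 0 := by exact_mod_cast hm0.ne'
  refine ⟨(‖m‖⁻¹ : ℂ) • m, by simp [norm_smul, hm0.ne'], fun y hy => ?_, fun s hs => ?_⟩
  · have h1 : (‖m‖⁻¹ : ℂ) • m - y = (‖m‖⁻¹ : ℂ) • (m - (‖m‖ : ℂ) • y) := by
      rw [smul_sub, smul_smul, inv_mul_cancel₀ hmc, one_smul]
    have h2 : (Submodule.Quotient.mk m : E ⧸ π.toRepresentation.invariants) =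
        Submodule.Quotient.mk (m - (‖m‖ : ℂ) • y) := by
      rw [Submodule.Quotient.eq, sub_sub_cancel]
      exact Submodule.smul_mem _ _ hy
    have h3 : 1 ≤ ‖m - (‖m‖ : ℂ) • y‖ := by
      rw [← hq, h2]
      exact Submodule.Quotient.norm_mk_le _ _
    rw [h1, norm_smul, norm_inv, Complex.norm_real, norm_norm, one_div]
    calc (2 : ℝ)⁻¹ ≤ ‖m‖⁻¹ := inv_anti₀ hm0 hm2.le
      _ ≤ _ := le_mul_of_one_le_right (inv_nonneg.mpr hm0.le) h3
  · have h1 := π.norm_sub_lt_of_norm_quotientRep_sub_lt (hqK s hs)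
    rw [mul_div_cancel₀ _ two_ne_zero] at h1
    rw [map_smul, ← smul_sub, norm_smul, norm_inv, Complex.norm_real, norm_norm]
    exact (mul_le_of_le_one_left (norm_nonneg _) (inv_le_one_of_one_le₀ hm1)).trans_lt h1

/-- Vectors that are almost invariant up to `ε` on compact sets `K` can be arranged in a net,
indexed by the pairs `(K, n)` with `ε = 1 / (n + 1)`. -/
theorem exists_isAlmostInvariant (π : IsometricRep G E) {P : E → Prop}
    (h : ∀ K : Set G, IsCompact K → ∀ ε : ℝ, 0 < ε →
      ∃ x : E, P x ∧ ∀ s ∈ K, ‖π.toHom s x - x‖ < ε) :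
    ∃ ξ : ULift.{u} (TopologicalSpace.Compacts G × ℕ) → E, (∀ i, P (ξ i)) ∧
      π.IsAlmostInvariant ξ := by
  choose ξ hP hξ using fun i : ULift.{u} (TopologicalSpace.Compacts G × ℕ) =>
    h i.down.1 i.down.1.isCompact (1 / ((i.down.2 : ℝ) + 1)) (by positivity)
  refine ⟨ξ, hP, fun K hK ε hε => ?_⟩
  obtain ⟨n, hn⟩ := exists_nat_one_div_lt hε
  refine ⟨⟨⟨K, hK⟩, n⟩, fun i hi s hs => ?_⟩
  have h1 : (⟨⟨K, hK⟩, n⟩ : TopologicalSpace.Compacts G × ℕ) ≤ i.down := hi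
  refine (hξ i s (h1.1 hs)).trans_le (le_trans ?_ hn.le)
  have h2 : (n : ℝ) ≤ i.down.2 := Nat.cast_le.mpr h1.2
  gcongr

end IsometricRep

/-! ### The bimodule of an isometric representation -/

section RepExtension

open SymmPseudo

variable {G : Type v} [Group G] [TopologicalSpace G] [IsTopologicalGroup G]
  [LocallyCompactSpace G] [MeasurableSpace G] [BorelSpace G]
  {R : Set (BanachRep.{u, v} G)} {μ : Measure G} [μ.IsHaarMeasure] [μ.Regular]
variable {E : Type u} [NormedAddCommGroup E] [NormedSpace ℂ E] [CompleteSpace E]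

variable (R μ) in
/-- The extension of the integrated form of `π` to the pseudofunction algebra. It has the expected
values on the image of `L¹(G)` if `π ∈ 𝓡*`; otherwise it need not extend anything. -/
noncomputable def IsometricRep.extension (π : IsometricRep G E) : SymmPseudo R μ →L[ℂ] E →L[ℂ] E :=
  LinearMap.extendOfNorm (π.integrated μ).toLinearMap (ofL1 R μ).toLinearMap

variable {π : IsometricRep G E}

theorem DualClosure.norm_integrated_le (hπ : DualClosure R ⟨E, π⟩) (f : Lp ℂ 1 μ) :
    ‖π.integrated μ f‖ ≤ 1 * ‖ofL1 R μ f‖ := by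
  rw [one_mul, norm_ofL1]
  exact le_symmNorm hπ f

theorem DualClosure.extension_ofL1 (hπ : DualClosure R ⟨E, π⟩) (f : Lp ℂ 1 μ) :
    π.extension R μ (ofL1 R μ f) = π.integrated μ f :=
  LinearMap.extendOfNorm_eq denseRange_ofL1 ⟨1, hπ.norm_integrated_le⟩ f

theorem DualClosure.norm_extension_le (hπ : DualClosure R ⟨E, π⟩) (a : SymmPseudo R μ) :
    ‖π.extension R μ a‖ ≤ ‖a‖ := by
  rw [← one_mul ‖a‖]
  exact LinearMap.norm_extendOfNorm_apply_le denseRange_ofL1 1 hπ.norm_integrated_le a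

theorem DualClosure.extension_mul (hπ : DualClosure R ⟨E, π⟩) (a b : SymmPseudo R μ) :
    π.extension R μ (a * b) = (π.extension R μ a).comp (π.extension R μ b) := by
  refine denseRange_ofL1.induction_on₂
    (p := fun a b => π.extension R μ (a * b) = (π.extension R μ a).comp (π.extension R μ b))
    (isClosed_eq (by fun_prop) (by fun_prop)) (fun f g => ?_) a b
  rw [← ofL1_conv, hπ.extension_ofL1, hπ.extension_ofL1, hπ.extension_ofL1, π.integrated_conv]

end RepExtension

section RepBimodule

open SymmPseudo

section TrivialRep

variable {G : Type v} [Group G] [TopologicalSpace G]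
variable {E : Type u} [NormedAddCommGroup E] [NormedSpace ℂ E]

variable (G E) in
/-- The trivial representation of `G` on `E`. -/
def trivialRep : IsometricRep G E where
  toHom := 1
  continuous_apply _ := continuous_const

theorem trivialRep_apply (s : G) (x : E) : (trivialRep G E).toHom s x = x := rfl

end TrivialRep

variable {G : Type v} [Group G] [TopologicalSpace G] [IsTopologicalGroup G]
  [LocallyCompactSpace G] [MeasurableSpace G] [BorelSpace G]
  {R : Set (BanachRep.{u, v} G)} {μ : Measure G} [μ.IsHaarMeasure] [μ.Regular]
variable {E : Type u} [NormedAddCommGroup E] [NormedSpace ℂ E] [CompleteSpace E]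

theorem integrated_trivialRep (f : Lp ℂ 1 μ) (x : E) :
    (trivialRep G E).integrated μ f x = (∫ s, f s ∂μ) • x := by
  rw [IsometricRep.integrated_apply]
  exact integral_smul_const _ _

theorem DualClosure.extension_trivialRep_comm (h1 : DualClosure R ⟨E, trivialRep G E⟩)
    (a : SymmPseudo R μ) (S : E →L[ℂ] E) :
    ((trivialRep G E).extension R μ a).comp S = S.comp ((trivialRep G E).extension R μ a) := by
  refine denseRange_ofL1.induction_on
    (p := fun a => ((trivialRep G E).extension R μ a).comp S =
      S.comp ((trivialRep G E).extension R μ a)) a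
    (isClosed_eq (by fun_prop) (by fun_prop)) fun f => ?_
  ext x
  simp only [h1.extension_ofL1, ContinuousLinearMap.comp_apply, integrated_trivialRep, map_smul]

variable {π : IsometricRep G E}

/-- The bimodule of a representation `π`: the left action is the integrated form of `π`, the right
action that of the trivial representation. -/
noncomputable def repBimodule (hπ : DualClosure R ⟨E, π⟩) (h1 : DualClosure R ⟨E, trivialRep G E⟩) :
    BanachBimodule (SymmPseudo R μ) E where
  left := (π.extension R μ).toLinearMap
  right := ((trivialRep G E).extension R μ).toLinearMap
  left_mul a b ξ := DFunLike.congr_fun (hπ.extension_mul a b) ξ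
  right_mul a b ξ := DFunLike.congr_fun
    ((h1.extension_mul a b).trans (h1.extension_trivialRep_comm a _)) ξ
  norm_left_le := hπ.norm_extension_le
  norm_right_le := h1.norm_extension_le
  comm a b ξ := DFunLike.congr_fun (h1.extension_trivialRep_comm b (π.extension R μ a)).symm ξ

variable (hπ : DualClosure R ⟨E, π⟩) (h1 : DualClosure R ⟨E, trivialRep G E⟩)

theorem repBimodule_left_ofL1 (f : Lp ℂ 1 μ) :
    (repBimodule hπ h1).left (ofL1 R μ f) = π.integrated μ f :=
  hπ.extension_ofL1 f

theorem repBimodule_right_ofL1 (f : Lp ℂ 1 μ) :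
    (repBimodule hπ h1).right (ofL1 R μ f) = (trivialRep G E).integrated μ f :=
  h1.extension_ofL1 f

theorem repBimodule_right_mean {V : Set G} {f : Lp ℂ 1 μ} (hf : IsMean V f) (x : E) :
    (repBimodule hπ h1).right (ofL1 R μ f) x = x := by
  rw [repBimodule_right_ofL1, integrated_trivialRep, hf.integral_eq_one, one_smul]

theorem repBimodule_isEssential : (repBimodule (μ := μ) hπ h1).IsEssential := by
  refine Dense.mono Submodule.subset_span fun x => Metric.mem_closure_iff.mpr fun ε hε => ?_
  have hV : ∀ᶠ s in 𝓝 (1 : G), dist (π.toHom s x) x < ε / 2 := by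
    have h := (π.continuous_apply x).tendsto 1
    rw [π.map_one_apply] at h
    exact Metric.tendsto_nhds.mp h _ (half_pos hε)
  obtain ⟨f, hf⟩ := exists_isMean (μ := μ) hV
  refine ⟨π.integrated μ f x, ⟨ofL1 R μ f, ofL1 R μ f, x, ?_⟩, ?_⟩
  · rw [repBimodule_right_mean hπ h1 hf, repBimodule_left_ofL1]
  · rw [dist_comm, dist_eq_norm]
    refine (hf.norm_integrated_sub_le π (half_pos hε).le fun s hs => ?_).trans_lt (half_lt_self hε)
    rw [← dist_eq_norm]
    exact le_of_lt hs

/-- Central vectors of the bimodule of `π` are invariant under `π`. -/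
theorem mem_invariants_of_isCentral {η : E} (hη : (repBimodule (μ := μ) hπ h1).IsCentral η) :
    η ∈ π.toRepresentation.invariants := by
  intro s
  obtain ⟨f, hf⟩ := exists_isMean (μ := μ) (univ_mem : Set.univ ∈ 𝓝 (1 : G))
  have h : ∀ g : Lp ℂ 1 μ, π.integrated μ g η = (trivialRep G E).integrated μ g η := fun g => by
    rw [← repBimodule_left_ofL1 hπ h1, ← repBimodule_right_ofL1 hπ h1]
    exact hη _
  have h2 : (trivialRep G E).integrated μ f η = η := by
    rw [integrated_trivialRep, hf.integral_eq_one, one_smul]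
  have h3 := h ((leftRegular μ).toHom s f)
  rwa [IsometricRep.integrated_leftRegular, IsometricRep.integrated_leftRegular, h, h2,
    trivialRep_apply] at h3

/-- A bounded family of operators converging pointwise to zero does so uniformly on compact
sets. -/
theorem exists_forall_norm_lt_of_isCompact {A F I : Type*} [NormedAddCommGroup A] [NormedSpace ℂ A]
    [NormedAddCommGroup F] [NormedSpace ℂ F] {l : Filter I} {T : I → A →L[ℂ] F} {C : ℝ}
    (hT : ∀ i, ‖T i‖ ≤ C) (h : ∀ a, Tendsto (fun i => T i a) l (𝓝 0)) {S : Set A}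
    (hS : IsCompact S) {ε : ℝ} (hε : 0 < ε) : ∀ᶠ i in l, ∀ a ∈ S, ‖T i a‖ < ε := by
  have hC : 0 < max C 0 + 1 := by positivity
  obtain ⟨t, -, ht, hSt⟩ := hS.finite_cover_balls (e := ε / 2 / (max C 0 + 1)) (by positivity)
  have hev : ∀ᶠ i in l, ∀ a ∈ t, ‖T i a‖ < ε / 2 := by
    refine (eventually_all_finite ht).mpr fun a _ => ?_
    simpa using Metric.tendsto_nhds.mp (h a) (ε / 2) (half_pos hε)
  filter_upwards [hev] with i hi a ha
  obtain ⟨b, hb, hab⟩ := Set.mem_iUnion₂.mp (hSt ha)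
  rw [Metric.mem_ball, dist_eq_norm, lt_div_iff₀ hC] at hab
  have h1 : ‖T i (a - b)‖ ≤ max C 0 * ‖a - b‖ :=
    (T i).le_of_opNorm_le ((hT i).trans (le_max_left _ _)) _
  calc ‖T i a‖ = ‖T i (a - b) + T i b‖ := by rw [map_sub, sub_add_cancel]
    _ ≤ ‖T i (a - b)‖ + ‖T i b‖ := norm_add_le _ _
    _ < ε := by nlinarith [hi b hb, norm_nonneg (a - b)]

variable {I : Type*} [Preorder I] {ζ : I → E}

/-- For an almost invariant net of unit vectors, `a · ζ_i - ζ_i · a → 0` for all `a`. -/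
theorem tendsto_left_sub_right (hζ : ∀ i, ‖ζ i‖ = 1) (hinv : π.IsAlmostInvariant ζ)
    (a : SymmPseudo R μ) : Tendsto (fun i => (repBimodule hπ h1).leftL.flip (ζ i) a -
      (repBimodule hπ h1).rightL.flip (ζ i) a) atTop (𝓝 0) := by
  let M := repBimodule (μ := μ) hπ h1
  refine tendsto_of_dense_span (T := fun i => M.leftL.flip (ζ i) - M.rightL.flip (ζ i)) (S := 0)
    (C := 2) (.of_forall fun i => M.norm_leftL_flip_sub_rightL_flip_le (hζ i))
    ((denseRange_ofL1.dense_image (ofL1 R μ).continuous dense_hasCompactSupport_L1).mono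
      Submodule.subset_span) ?_ a
  · rintro _ ⟨f, ⟨g, -, hg, hfg⟩, rfl⟩
    have hf : ∀ᵐ s ∂μ, s ∉ tsupport g → f s = 0 := by
      filter_upwards [hfg] with s hs hsg
      rw [hs, image_eq_zero_of_notMem_tsupport hsg]
    rw [Metric.tendsto_nhds]
    intro ε hε
    obtain ⟨i₀, hi₀⟩ := hinv _ hg (ε / (‖f‖ + 1)) (by positivity)
    filter_upwards [eventually_ge_atTop i₀] with i hi
    have h2 : M.left (ofL1 R μ f) (ζ i) - M.right (ofL1 R μ f) (ζ i) =
        ∫ s, f s • (π.toHom s (ζ i) - ζ i) ∂μ := by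
      rw [repBimodule_left_ofL1, repBimodule_right_ofL1, integrated_trivialRep,
        π.integrated_apply, ← integral_smul_const, ← integral_sub (π.integrable_smul f _)
        ((L1.integrable_coeFn f).smul_const _)]
      simp only [smul_sub]
    have h3 := norm_integral_smul_le_of_eq_zero_off hf fun s hs => (hi₀ i hi s hs).le
    rw [zero_apply, dist_zero_right]
    change ‖M.left (ofL1 R μ f) (ζ i) - M.right (ofL1 R μ f) (ζ i)‖ < ε
    rw [h2]
    refine h3.trans_lt ?_
    rw [mul_div_assoc', div_lt_iff₀ (by positivity)]
    nlinarith [norm_nonneg f]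

/-- An almost invariant net of unit vectors is asymptotic to a strictly almost central one. -/
theorem exists_isStrictlyAlmostCentral [IsDirectedOrder I] [Nonempty I] (hζ : ∀ i, ‖ζ i‖ = 1)
    (hinv : π.IsAlmostInvariant ζ) :
    ∃ ξ : I → E, (∀ i, ‖ξ i‖ = 1) ∧ (repBimodule (μ := μ) hπ h1).IsStrictlyAlmostCentral ξ ∧
      Tendsto (fun i => ‖ζ i - ξ i‖) atTop (𝓝 0) := by
  let M := repBimodule (μ := μ) hπ h1
  have hM : M.IsEssential := repBimodule_isEssential hπ h1
  obtain ⟨V, hV, hV1⟩ := exists_compact_mem_nhds (1 : G)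
  obtain ⟨f, hf⟩ := exists_isMean (μ := μ) hV1
  -- smoothing the net by a fixed mean turns strict compactness of a set of multipliers into norm
  -- compactness of a set of elements of the algebra
  let e := ofL1 R μ f
  let D : I → E := fun i => M.left e (ζ i)
  have hD : ∀ ε : ℝ, 0 < ε → ∀ᶠ i in atTop, ‖D i - ζ i‖ ≤ ε := by
    intro ε hε
    obtain ⟨i₀, hi₀⟩ := hinv V hV ε hε
    filter_upwards [eventually_ge_atTop i₀] with i hi
    change ‖M.left (ofL1 R μ f) (ζ i) - ζ i‖ ≤ ε
    rw [repBimodule_left_ofL1]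
    exact hf.norm_integrated_sub_le π hε.le fun s hs => (hi₀ i hi s hs).le
  have hhalf : ∀ i, ‖D i - ζ i‖ ≤ 1 / 2 → 1 / 2 ≤ ‖D i‖ := by
    intro i hi
    have h := norm_sub_norm_le (ζ i) (D i)
    rw [hζ, norm_sub_rev] at h
    linarith
  classical
  let ξ : I → E := fun i => if D i = 0 then ζ i else (‖D i‖⁻¹ : ℂ) • D i
  have hξ : ∀ i, 1 / 2 ≤ ‖D i‖ → ξ i = (‖D i‖⁻¹ : ℂ) • D i := fun i hi =>
    if_neg (norm_pos_iff.mp (one_half_pos.trans_le hi))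
  refine ⟨ξ, fun i => ?_, fun S hS ε hε => ?_, ?_⟩
  · by_cases h0 : D i = 0
    · simp only [ξ, if_pos h0, hζ]
    · simp only [ξ, if_neg h0, norm_smul, norm_inv, Complex.norm_real, norm_norm]
      exact inv_mul_cancel₀ (norm_ne_zero_iff.mpr h0)
  · let K : Set (SymmPseudo R μ) := (fun x : 𝓜(ℂ, SymmPseudo R μ) => x.fst e) '' S
    have hK : IsCompact K :=
      @IsCompact.image _ _ (strictTopology _) _ S _ hS (continuous_strictTopology_fst e)
    obtain ⟨B, hB⟩ := hK.isBounded.exists_norm_le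
    have hBp : 0 < |B| + 1 := by positivity
    have hev1 := exists_forall_norm_lt_of_isCompact (l := atTop)
      (fun i => M.norm_leftL_flip_sub_rightL_flip_le (hζ i))
      (tendsto_left_sub_right hπ h1 hζ hinv) hK (ε := ε / 4) (by positivity)
    refine eventually_atTop.mp ?_
    filter_upwards [hev1, hD (1 / 2) one_half_pos, hD (ε / 8 / (|B| + 1)) (by positivity)]
      with i hi1 hi2 hi3 x hx
    have hDi := hhalf i hi2
    have hxK : x.fst e ∈ K := ⟨x, hx, rfl⟩
    -- the right action of the mean `e` is trivial, so `x` acts from the right through `x e`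
    have hright : M.rightMult x (D i) = M.right (x.fst e) (D i) := by
      have h2 := hM.right_rightMult hasBoundedApproxUnit x e (D i)
      rwa [repBimodule_right_mean hπ h1 hf] at h2
    have hdiff : M.leftMult x (D i) - M.rightMult x (D i) =
        (M.left (x.fst e) (ζ i) - M.right (x.fst e) (ζ i)) - M.right (x.fst e) (D i - ζ i) := by
      rw [hright, hM.leftMult_left hasBoundedApproxUnit, map_sub]
      abel
    have hn1 : ‖M.left (x.fst e) (ζ i) - M.right (x.fst e) (ζ i)‖ < ε / 4 := hi1 _ hxK
    have hn2 : ‖M.right (x.fst e) (D i - ζ i)‖ ≤ ε / 8 := by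
      refine ((M.right _).le_of_opNorm_le ((M.norm_right_le _).trans (hB _ hxK)) _).trans ?_
      rw [le_div_iff₀ hBp] at hi3
      nlinarith [le_abs_self B, norm_nonneg (D i - ζ i)]
    have hn3 : ‖M.leftMult x (D i) - M.rightMult x (D i)‖ < ε / 2 := by
      rw [hdiff]
      refine (norm_sub_le _ _).trans_lt ?_
      linarith
    have hinv2 : ‖D i‖⁻¹ ≤ 2 := by
      refine (inv_anti₀ one_half_pos hDi).trans (by norm_num)
    rw [hξ i hDi, map_smul, map_smul, ← smul_sub, norm_smul, norm_inv, Complex.norm_real, norm_norm]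
    have hfin := mul_le_mul_of_nonneg_right hinv2
      (norm_nonneg (M.leftMult x (D i) - M.rightMult x (D i)))
    linarith
  · refine Metric.tendsto_nhds.mpr fun ε hε => ?_
    filter_upwards [hD (1 / 2) one_half_pos, hD (ε / 4) (by positivity)] with i hi1 hi2
    have hDi := hhalf i hi1
    have hD0 : 0 < ‖D i‖ := one_half_pos.trans_le hDi
    have h2 : ‖D i - ξ i‖ = |‖D i‖ - 1| := by
      have h3 : D i - ξ i = ((‖D i‖ - 1 : ℝ) : ℂ) • (‖D i‖⁻¹ : ℂ) • D i := by
        have hc : (‖D i‖ : ℂ) ≠ 0 := by exact_mod_cast hD0.ne'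
        rw [hξ i hDi, Complex.ofReal_sub, Complex.ofReal_one, sub_smul, one_smul, smul_smul,
          mul_inv_cancel₀ hc, one_smul]
      rw [h3, norm_smul, norm_smul, norm_inv, Complex.norm_real, Complex.norm_real, norm_norm,
        inv_mul_cancel₀ hD0.ne', mul_one, Real.norm_eq_abs]
    have h3 : |‖D i‖ - 1| ≤ ‖D i - ζ i‖ := by
      have h := abs_norm_sub_norm_le (D i) (ζ i)
      rwa [hζ] at h
    rw [dist_zero_right, norm_norm]
    calc ‖ζ i - ξ i‖ = ‖(D i - ξ i) - (D i - ζ i)‖ := by rw [sub_sub_sub_cancel_left]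
      _ ≤ ‖D i - ξ i‖ + ‖D i - ζ i‖ := norm_sub_le _ _
      _ < ε := by linarith

end RepBimodule

theorem theoremA {G : Type v} [Group G] [TopologicalSpace G] [IsTopologicalGroup G]
    [LocallyCompactSpace G] [T2Space G] [MeasurableSpace G] [BorelSpace G]
    (μ : Measure G) [μ.IsHaarMeasure] [μ.Regular] (𝓔 : BanachClass.{u}) :
    (GroupPropertyT G 𝓔 ↔ AlgebraPropertyT (FStar 𝓔 μ) 𝓔) ∧
    (GroupWeakPropertyT G 𝓔 ↔ AlgebraWeakPropertyT (FStar 𝓔 μ) 𝓔) := by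
  have hrep : ∀ (E : Type u) [NormedAddCommGroup E] [NormedSpace ℂ E] [CompleteSpace E], 𝓔 E →
      ∀ π : IsometricRep G E, DualClosure (repClass G 𝓔) ⟨E, π⟩ :=
    fun E _ _ _ hE π => DualClosure.base _ hE
  refine ⟨⟨fun h => ⟨SymmPseudo.hasBoundedApproxUnit, ?_⟩, fun ⟨_, h⟩ => ?_⟩,
    ⟨fun h => ⟨SymmPseudo.hasBoundedApproxUnit, ?_⟩, fun ⟨_, h⟩ => ?_⟩⟩
  · intro E _ _ _ hE M hM I _ _ _ ξ _ hξ
    obtain ⟨η, hη, hlim⟩ := (hξ.isAlmostInvariant hM).exists_tendsto (h E hE (M.conjRep hM))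
    exact ⟨η, fun i => BanachBimodule.isCentral_of_mem_invariants hM (hη i), hlim⟩
  · intro E _ _ _ hE π hq
    obtain ⟨ζ, hζ, hinv⟩ := π.exists_isAlmostInvariant
      (P := fun x => ‖x‖ = 1 ∧ ∀ y ∈ π.toRepresentation.invariants, 1 / 2 ≤ ‖x - y‖)
      fun K hK ε hε => by
        obtain ⟨x, hx, hy, hs⟩ := π.exists_lift_of_hasAlmostInvariantVectors hq hK hε
        exact ⟨x, ⟨hx, hy⟩, hs⟩
    have hπ := hrep E hE π
    have h1 := hrep E hE (trivialRep G E)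
    obtain ⟨ξ, hξ, hc, hlim⟩ :=
      exists_isStrictlyAlmostCentral (μ := μ) hπ h1 (fun i => (hζ i).1) hinv
    obtain ⟨η, hη, hlim'⟩ := h E hE _ (repBimodule_isEssential hπ h1) _ ξ hξ hc
    have hsum := hlim.add hlim'
    rw [add_zero] at hsum
    obtain ⟨i, hi⟩ := (hsum.eventually (gt_mem_nhds one_half_pos)).exists
    have h2 := (hζ i).2 (η i) (mem_invariants_of_isCentral hπ h1 (hη i))
    exact absurd (h2.trans (norm_sub_le_norm_sub_add_norm_sub _ (ξ i) _)) (not_le.mpr hi)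
  · intro E _ _ _ hE M hM I _ _ _ ξ hξ1 hξ
    obtain ⟨η, hη, hη0⟩ := h E hE (M.conjRep hM) fun K hK ε hε => by
      obtain ⟨i, hi⟩ := hξ.isAlmostInvariant hM K hK ε hε
      exact ⟨ξ i, hξ1 i, hi i le_rfl⟩
    exact ⟨η, BanachBimodule.isCentral_of_mem_invariants hM hη, hη0⟩
  · intro E _ _ _ hE π hai
    obtain ⟨ζ, hζ, hinv⟩ := π.exists_isAlmostInvariant (P := fun x => ‖x‖ = 1) hai
    have hπ := hrep E hE π
    have h1 := hrep E hE (trivialRep G E)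
    obtain ⟨ξ, hξ, hc, -⟩ := exists_isStrictlyAlmostCentral (μ := μ) hπ h1 hζ hinv
    obtain ⟨η, hη, hη0⟩ := h E hE _ (repBimodule_isEssential hπ h1) _ ξ hξ hc
    exact ⟨η, mem_invariants_of_isCentral hπ h1 hη, hη0⟩
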